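/- Let $n\ge 0$. Let $M^n$ be the complex vector space with basis the words $w=w_1w_2\cdots w_n$ in the letters $1,\dots,n$; the symmetric group $S_n$, and hence the group algebra $\mathbb{C}[S_n]$, acts on it by place permutations, $\sigma(w)=w_{\sigma^{-1}(1)}\cdots w_{\sigma^{-1}(n)}$. Let $$Q_n=\sum_{1\le i\le j\le n}\frac1j\,(i\;j)\in\mathbb{C}[S_n],$$ where $(j\;j)$ is the identity. For a partition $\lambda\vdash n$ let $S^\lambda\subset M^n$ be the Specht module, that is, the span of the elements $s(T)=\sum_{\sigma\in C_T}\operatorname{sign}(\sigma)\,w(\sigma(T))$, where $T$ runs over the bijective fillings of the diagram of $\lambda$ by $1,\dots,n$, $C_T\subset S_n$ is the column stabilizer of $T$, and $w(T)$ is the word with the letter $i$ in the positions given by the entries of row $i$ of $T$. An eigenvector is a nonzero $v$ with $Q_nv\in\mathbb{C}v$. For $\lambda\vdash n$ and $\mu\vdash n+1$ with $\lambda\subset\mu$, let $a$ be the row of the box of $\mu$ not in $\lambda$, let $\Phi_a:M^n\to M^{n+1}$ be the linear map $w\mapsto w\cdot a$ that appends the letter $a$, let $\pi^\mu$ be the projection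 of $M^{n+1}$ onto its $S^\mu$-isotypic component (along the other isotypic components), and define the lifting operator $\kappa^{\lambda,\mu}=\pi^\mu\circ\Phi_a|_{S^\lambda}$. Then for every $\mu\vdash n+1$ the following hold. 1. For every $\lambda\vdash n$ with $\lambda\subset\mu$, the operator $\kappa^{\lambda,\mu}$ maps $S^\lambda$ into $S^\mu$, is injective, and is a morphism of $S_n$-modules, where $S_n\subset S_{n+1}$ is the stabilizer of $n+1$. 2. Every $S^\lambda$ with $\lambda\vdash n$ and $\lambda\subset\mu$ has a basis of eigenvectors of $Q_n$. 3. Whenever $(b^\lambda_i)_i$ is, for each $\lambda\vdash n$ with $\lambda\subset\mu$, a basis of $S^\lambda$ consisting of eigenvectors of $Q_n$, the lifted vectors $\kappa^{\lambda,\mu}(b^\lambda_i)$, for all such $\lambda$ and all $i$, together form a basis of $S^\mu$, and they are eigenvectors of $Q_{n+1}$. -/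

import Mathlib

open Equiv

noncomputable section

namespace OneSidedShuffle

/-! ### Isotypic projections -/

section Isotypic

variable (R M S : Type*) [Ring R] [AddCommGroup M] [AddCommGroup S] [Module R M] [Module R S]

/-- The sum of all simple submodules of `M` that are isomorphic to `S`. -/
def isotypicPart : Submodule R M :=
  sSup {m : Submodule R M | IsSimpleModule R m ∧ Nonempty (m ≃ₗ[R] S)}

/-- The sum of all simple submodules of `M` that are not isomorphic to `S`. -/
def antiIsotypicPart : Submodule R M :=
  sSup {m : Submodule R M | IsSimpleModule R m ∧ ¬ Nonempty (m ≃ₗ[R] S)}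

/-- For a simple module `S`, `isotypicPart` is Mathlib's `S`-isotypic component. -/
theorem isotypicPart_eq [IsSimpleModule R S] :
    isotypicPart R M S = isotypicComponent R M S := by
  unfold isotypicPart isotypicComponent
  congr 1
  ext m
  exact ⟨fun h => h.2, fun h => ⟨IsSimpleModule.congr h.some, h⟩⟩

/-- A semisimple module is the direct sum of its `S`-isotypic part and of the sum of the simple
submodules of all the other isomorphism types. -/
theorem isCompl_isotypicPart [IsSemisimpleModule R M] :
    IsCompl (isotypicPart R M S) (antiIsotypicPart R M S) := by
  constructor
  · rw [disjoint_iff]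
    by_contra hne
    obtain ⟨m, hm, hs⟩ := (IsSemisimpleModule.eq_bot_or_exists_simple_le _).resolve_left hne
    have h1 : ∀ p : {m : Submodule R M | IsSimpleModule R m ∧ Nonempty (m ≃ₗ[R] S)},
      IsSimpleModule R p := fun p => p.2.1
    have h2 : ∀ p : {m : Submodule R M | IsSimpleModule R m ∧ ¬ Nonempty (m ≃ₗ[R] S)},
      IsSimpleModule R p := fun p => p.2.1
    obtain ⟨p, hp, ⟨e⟩⟩ := m.linearEquiv_of_le_sSup _ (hm.trans inf_le_left)
    obtain ⟨q, hq, ⟨f⟩⟩ := m.linearEquiv_of_le_sSup _ (hm.trans inf_le_right)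
    exact hq.2 ⟨(f.symm.trans e).trans hp.2.some⟩
  · rw [codisjoint_iff, eq_top_iff, ← IsSemisimpleModule.sSup_simples_eq_top R M]
    refine sSup_le fun m hm => ?_
    by_cases h : Nonempty (m ≃ₗ[R] S)
    · exact le_sup_of_le_left (le_sSup ⟨hm, h⟩)
    · exact le_sup_of_le_right (le_sSup ⟨hm, h⟩)

/-- The isotypic projection of a semisimple module `M` onto its `S`-isotypic component: the
identity on simple submodules isomorphic to `S`, zero on all other simple submodules. -/
def isotypicProj [IsSemisimpleModule R M] : M →ₗ[R] M :=
  (isotypicPart R M S).projection (antiIsotypicPart R M S) (isCompl_isotypicPart R M S)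

end Isotypic

/-! ### Words, and the action of the symmetric group by place permutations -/

/-- Words of length `n` in `n` letters; letters and positions are numbered from `0`. -/
abbrev Word (n : ℕ) : Type := Fin n → Fin n

/-- The group algebra `ℂ[S_n]`. -/
abbrev GroupAlg (n : ℕ) : Type := MonoidAlgebra ℂ (Perm (Fin n))

/-- The representation of `S_n` on the space with basis the words, by place permutations:
`σ(w) = w_{σ⁻¹(1)} ⋯ w_{σ⁻¹(n)}`. -/
def wordRep (n : ℕ) : Representation ℂ (Perm (Fin n)) (Word n →₀ ℂ) where
  toFun σ := Finsupp.lmapDomain ℂ ℂ (fun w : Word n => fun k => w (σ⁻¹ k))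
  map_one' := by
    refine Finsupp.lhom_ext' fun w => LinearMap.ext_ring ?_
    simp
  map_mul' σ τ := by
    refine Finsupp.lhom_ext' fun w => LinearMap.ext_ring ?_
    simp [Finsupp.mapDomain_single, mul_inv_rev]

/-- The space `M^n` with basis the words of length `n`. -/
abbrev WordModule (n : ℕ) : Type := Word n →₀ ℂ

/-- `M^n` is a module over `ℂ[S_n]` through the action of `S_n` by place permutations. -/
instance instModuleGroupAlg (n : ℕ) : Module (GroupAlg n) (WordModule n) :=
  Module.compHom (WordModule n) (wordRep n).asAlgebraHom.toRingHom

theorem groupAlg_smul_def {n : ℕ} (r : GroupAlg n) (v : WordModule n) :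
    r • v = (wordRep n).asAlgebraHom r v := rfl

instance instScalarTower (n : ℕ) : IsScalarTower ℂ (GroupAlg n) (WordModule n) where
  smul_assoc c r v := by
    rw [groupAlg_smul_def, groupAlg_smul_def, map_smul, LinearMap.smul_apply]

/-- The basis element of `M^n` given by a word. -/
def word {n : ℕ} (w : Word n) : WordModule n := Finsupp.single w 1

theorem single_smul_word {n : ℕ} (σ : Perm (Fin n)) (w : Word n) :
    (MonoidAlgebra.single σ 1 : GroupAlg n) • word w = word (fun k => w (σ⁻¹ k)) := by
  rw [groupAlg_smul_def, Representation.asAlgebraHom_single]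
  simp [wordRep, word, Finsupp.mapDomain_single]

/-! ### Partitions, tableaux and Specht modules -/

/-- Partitions of `n`, as Young diagrams with `n` boxes; the box `(i, j)` is the one in row `i` and
column `j`, both numbered from `0`. -/
abbrev PartitionOf (n : ℕ) : Type := {lam : YoungDiagram // lam.card = n}

theorem row_lt_card {lam : YoungDiagram} {c : ℕ × ℕ} (hc : c ∈ lam.cells) : c.1 < lam.card := by
  have h : c.1 < lam.colLen c.2 := YoungDiagram.mem_iff_lt_colLen.1 hc
  rw [YoungDiagram.colLen_eq_card] at h
  exact h.trans_le (Finset.card_le_card (Finset.filter_subset _ _))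

/-- Young tableaux of shape `lam`: bijective fillings of the boxes by the numbers `0, …, n - 1`.
The entry of the box `c` is `T c`, and `T.symm k` is the box with entry `k`. -/
abbrev Tableau {n : ℕ} (lam : PartitionOf n) : Type := lam.1.cells ≃ Fin n

/-- The word `w(T)`: it has the letter `i` in the positions given by the entries of row `i`. -/
def tableauWord {n : ℕ} {lam : PartitionOf n} (T : Tableau lam) : Word n := fun k =>
  ⟨(T.symm k).1.1, (row_lt_card (T.symm k).2).trans_eq lam.2⟩

/-- The column stabilizer `C_T`: permutations that keep every entry of `T` in its column. -/
def colStab {n : ℕ} {lam : PartitionOf n} (T : Tableau lam) : Finset (Perm (Fin n)) :=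
  Finset.univ.filter fun σ => ∀ k, (T.symm (σ k)).1.2 = (T.symm k).1.2

/-- The polytabloid `s(T) = ∑_{σ ∈ C_T} sign(σ) w(σ(T))`, where `σ` acts on the entries of `T`. -/
def polytabloid {n : ℕ} {lam : PartitionOf n} (T : Tableau lam) : WordModule n :=
  ∑ σ ∈ colStab T, (((Perm.sign σ : ℤ) : ℂ)) • word (tableauWord (T.trans σ))

theorem single_smul_polytabloid {n : ℕ} {lam : PartitionOf n} (τ : Perm (Fin n)) (T : Tableau lam) :
    (MonoidAlgebra.single τ 1 : GroupAlg n) • polytabloid T = polytabloid (T.trans τ) := by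
  unfold polytabloid
  rw [Finset.smul_sum]
  refine Finset.sum_bij' (fun σ _ => τ * σ * τ⁻¹) (fun σ _ => τ⁻¹ * σ * τ) ?_ ?_ ?_ ?_ ?_
  · intro σ hσ
    simp only [colStab, Finset.mem_filter, Finset.mem_univ, true_and] at hσ ⊢
    intro k
    have h := hσ (τ⁻¹ k)
    simpa [Perm.mul_apply, Perm.inv_def] using h
  · intro σ hσ
    simp only [colStab, Finset.mem_filter, Finset.mem_univ, true_and] at hσ ⊢
    intro k
    have h := hσ (τ k)
    simpa [Perm.mul_apply, Perm.inv_def] using h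
  · intro σ _; group
  · intro σ _; group
  · intro σ _
    rw [smul_comm, single_smul_word]
    congr 1
    · have hs : Perm.sign (τ * σ * τ⁻¹) = Perm.sign σ := by
        rw [Perm.sign_mul, Perm.sign_mul, Perm.sign_inv, mul_right_comm, Int.units_mul_self, one_mul]
      rw [hs]
    · congr 1
      funext k
      have hk : τ⁻¹ ((τ * σ * τ⁻¹)⁻¹ k) = σ⁻¹ (τ⁻¹ k) := by
        simp [mul_inv_rev, Perm.mul_apply]
      have h2 : (T.trans τ).symm ((τ * σ * τ⁻¹)⁻¹ k) = T.symm (τ⁻¹ ((τ * σ * τ⁻¹)⁻¹ k)) := rfl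
      apply Fin.ext
      change (T.symm (σ⁻¹ (τ⁻¹ k))).1.1 = ((T.trans τ).symm ((τ * σ * τ⁻¹)⁻¹ k)).1.1
      rw [h2, hk]

/-- The Specht module `S^lam` inside `M^n`: the complex span of the polytabloids of all tableaux of
shape `lam` (those of the standard tableaux form a basis of it), as a `ℂ[S_n]`-submodule. -/
def specht {n : ℕ} (lam : PartitionOf n) : Submodule (GroupAlg n) (WordModule n) where
  carrier := Submodule.span ℂ (Set.range fun T : Tableau lam => polytabloid T)
  add_mem' := Submodule.add_mem _
  zero_mem' := Submodule.zero_mem _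
  smul_mem' r v hv := by
    simp only [SetLike.mem_coe] at hv ⊢
    induction r using MonoidAlgebra.induction_linear with
    | zero => simp
    | add f g hf hg => rw [add_smul]; exact Submodule.add_mem _ hf hg
    | single σ c =>
      have hc : (MonoidAlgebra.single σ c : GroupAlg n) = c • MonoidAlgebra.single σ 1 := by simp
      rw [hc, smul_assoc]
      refine Submodule.smul_mem _ _ ?_
      induction hv using Submodule.span_induction with
      | mem x hx =>
        obtain ⟨T, rfl⟩ := hx
        rw [single_smul_polytabloid]
        exact Submodule.subset_span ⟨_, rfl⟩
      | zero => simp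
      | add x y _ _ hx hy => rw [smul_add]; exact Submodule.add_mem _ hx hy
      | smul a x _ hx => rw [smul_comm]; exact Submodule.smul_mem _ _ hx

/-! ### The shuffle element and its eigenvectors -/

/-- `Q_n = ∑_{1 ≤ i ≤ j ≤ n} (1/j) (i j) ∈ ℂ[S_n]`, where `(j j)` is the identity (with positions
numbered from `0`, so that the coefficient is `1/(j+1)`). -/
def shuffle (n : ℕ) : GroupAlg n :=
  ∑ j : Fin n, ∑ i ∈ Finset.Iic j, MonoidAlgebra.single (swap i j) (1 / ((j : ℂ) + 1))

/-- `v ∈ M^n` is an eigenvector of `Q_n`. -/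
def IsShuffleEigenvector {n : ℕ} (v : WordModule n) : Prop :=
  v ≠ 0 ∧ ∃ c : ℂ, shuffle n • v = c • v

/-! ### Lifting operators -/

/-- The adding operator `Φ_a : M^n → M^{n+1}`, which appends the letter `a` to every word. -/
def adding {n : ℕ} (a : Fin (n + 1)) : WordModule n →ₗ[ℂ] WordModule (n + 1) :=
  Finsupp.lmapDomain ℂ ℂ
    (fun w : Word n => (Fin.snoc (fun k => (w k).castSucc) a : Word (n + 1)))

theorem exists_addedBox {n : ℕ} {lam : PartitionOf n} {mu : PartitionOf (n + 1)} (h : lam.1 ≤ mu.1) :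
    ∃ c, mu.1.cells \ lam.1.cells = {c} := by
  rw [← Finset.card_eq_one, Finset.card_sdiff_of_subset (YoungDiagram.cells_subset_iff.2 h)]
  have h1 := lam.2
  have h2 := mu.2
  unfold YoungDiagram.card at h1 h2
  omega

/-- For `lam ⊂ mu` with `n` and `n + 1` boxes: the index `a` of the row with `mu = lam + e_a`,
that is, the row of the unique box of `mu` that is not in `lam`. -/
def addedRow {n : ℕ} {lam : PartitionOf n} {mu : PartitionOf (n + 1)} (h : lam.1 ≤ mu.1) : Fin (n + 1) :=
  ⟨(exists_addedBox h).choose.1, by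
    have hm : (exists_addedBox h).choose ∈ mu.1.cells \ lam.1.cells :=
      (Finset.ext_iff.1 (exists_addedBox h).choose_spec _).2 (Finset.mem_singleton_self _)
    exact (row_lt_card (Finset.mem_sdiff.1 hm).1).trans_eq mu.2⟩

/-- The lifting operator `κ_a^{lam,mu} = π^mu ∘ Φ_a` on `S^lam`, where `mu = lam + e_a` and `π^mu`
is the isotypic projection of `M^{n+1}` belonging to `S^mu`. -/
def lifting {n : ℕ} {lam : PartitionOf n} {mu : PartitionOf (n + 1)} (h : lam.1 ≤ mu.1) :
    specht lam →ₗ[ℂ] WordModule (n + 1) :=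
  (isotypicProj (GroupAlg (n + 1)) (WordModule (n + 1)) (specht mu)).restrictScalars ℂ ∘ₗ
    adding (addedRow h) ∘ₗ (specht lam).subtype.restrictScalars ℂ

/-- The inclusion `S_n ⊂ S_{n+1}` as the stabilizer of the last position. -/
def inclPerm {n : ℕ} (σ : Perm (Fin n)) : Perm (Fin (n + 1)) :=
  σ.viaEmbedding Fin.castSuccEmb

end OneSidedShuffle

end

open OneSidedShuffle

open Equiv

noncomputable section

namespace OneSidedShuffle

/-! ### Naturality of the isotypic projections -/

section IsotypicNaturality

variable {R M M' S : Type*} [Ring R] [AddCommGroup M] [AddCommGroup M'] [AddCommGroup S]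
  [Module R M] [Module R M'] [Module R S]

/-! Everything rests on grading `M^n` by the sum of the letters of a word, which place permutations
preserve. With letters numbered from 0, `S^lam` lies in degree `rowSum lam`. The column
antisymmetrizer of a tableau `T` of shape `lam` kills all words of smaller degree and sends words of
degree `rowSum lam` to multiples of `polytabloid T` (`antisym_smul_word_cases`). So a homomorphism
`S^lam → M^n` followed by projection to that degree is a scalar (`exists_sumProj_hom_eq_smul`). It
follows that the `S^lam` are simple, pairwise non-isomorphic, and that the isotypic projection sends
degree `rowSum lam` into `S^lam` itself.

Appending the letter `a` raises the degree by `a`, which is `rowSum mu - rowSum lam`; hence the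
lifting lands in `S^mu`. It is equivariant, and nonzero because an antisymmetrizer carries the lift
of a polytabloid to a nonzero multiple of a polytabloid; simplicity makes it injective.

That the lifts fill `S^mu` is a dimension count. The lifts from different `lam` are independent, so
`∑ dim S^lam ≤ dim S^mu` over the lower neighbours. Conversely, the diagonal lift of `S^lam`
generates every upper neighbour using `n + 1` cosets, so `∑ dim S^mu ≤ (n + 1) dim S^lam`. The
relation `DU = UD + 1` on Young's lattice forces equality in both bounds, by induction on `n`
(`branching_of_le`).

Finally, `Q_{n+1} = Q_n + (J + 1)/(n + 1)`, where the Jucys-Murphy element `J` is half of `Z_{n+1} -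
Z_n - 1` and `Z_n = ∑_{i,j} (i j)` is central. By Schur's lemma `Z_n` and `Z_{n+1}` act as scalars
on `S^lam` and `S^mu`, so lifts of eigenvectors are eigenvectors; induction from `Q_0 = 0` gives the
eigenbases. -/

theorem map_isotypicPart_le (f : M →ₗ[R] M') :
    (isotypicPart R M S).map f ≤ isotypicPart R M' S := by
  unfold isotypicPart
  rw [sSup_eq_iSup', Submodule.map_iSup]
  refine iSup_le fun m => ?_
  obtain ⟨m, hm, ⟨e⟩⟩ := m
  rcases (LinearMap.injective_or_eq_zero (f.domRestrict m)) with h | h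
  · have e' : m ≃ₗ[R] m.map f := (LinearEquiv.ofInjective _ h).trans
      (LinearEquiv.ofEq _ _ (by rw [LinearMap.range_domRestrict]))
    exact le_sSup ⟨IsSimpleModule.congr e'.symm, ⟨e'.symm.trans e⟩⟩
  · rw [← LinearMap.range_domRestrict, h]
    simp

theorem map_antiIsotypicPart_le (f : M →ₗ[R] M') :
    (antiIsotypicPart R M S).map f ≤ antiIsotypicPart R M' S := by
  unfold antiIsotypicPart
  rw [sSup_eq_iSup', Submodule.map_iSup]
  refine iSup_le fun m => ?_
  obtain ⟨m, hm, hn⟩ := m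
  rcases (LinearMap.injective_or_eq_zero (f.domRestrict m)) with h | h
  · have e' : m ≃ₗ[R] m.map f := (LinearEquiv.ofInjective _ h).trans
      (LinearEquiv.ofEq _ _ (by rw [LinearMap.range_domRestrict]))
    exact le_sSup ⟨IsSimpleModule.congr e'.symm, fun ⟨e⟩ => hn ⟨e'.trans e⟩⟩
  · rw [← LinearMap.range_domRestrict, h]
    simp

theorem isotypicProj_of_mem [IsSemisimpleModule R M] {x : M} (hx : x ∈ isotypicPart R M S) :
    isotypicProj R M S x = x :=
  Submodule.projection_apply_of_mem_left _ hx

theorem isotypicProj_of_mem_anti [IsSemisimpleModule R M] {x : M}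
    (hx : x ∈ antiIsotypicPart R M S) : isotypicProj R M S x = 0 :=
  (Submodule.projection_apply_eq_zero_iff _).2 hx

theorem isotypicProj_mem [IsSemisimpleModule R M] (x : M) :
    isotypicProj R M S x ∈ isotypicPart R M S :=
  Submodule.projection_apply_mem _ x

/-- Isotypic projections commute with module homomorphisms. -/
theorem isotypicProj_map [IsSemisimpleModule R M] [IsSemisimpleModule R M'] (f : M →ₗ[R] M')
    (x : M) : isotypicProj R M' S (f x) = f (isotypicProj R M S x) := by
  have h1 : f (isotypicProj R M S x) ∈ isotypicPart R M' S :=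
    map_isotypicPart_le f (Submodule.mem_map_of_mem (isotypicProj_mem x))
  have h2 : f (x - isotypicProj R M S x) ∈ antiIsotypicPart R M' S :=
    map_antiIsotypicPart_le f (Submodule.mem_map_of_mem (Submodule.sub_projection_mem _ x))
  have h3 : f x = f (isotypicProj R M S x) + f (x - isotypicProj R M S x) := by
    rw [← map_add]; simp
  rw [h3, map_add, isotypicProj_of_mem h1, isotypicProj_of_mem_anti h2, add_zero]

/-- Naturality for the inclusion of `N`. It extracts the isotypic components of a vector without
leaving a submodule. -/
theorem isotypicProj_mem_submodule [IsSemisimpleModule R M] (N : Submodule R M) {x : M}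
    (hx : x ∈ N) : isotypicProj R M S x ∈ N := by
  have h := isotypicProj_map (S := S) N.subtype ⟨x, hx⟩
  simp only [Submodule.subtype_apply] at h
  rw [h]
  exact Subtype.property _

theorem isotypicProj_of_mem_simple [IsSemisimpleModule R M] {m : Submodule R M}
    [IsSimpleModule R m] (e : m ≃ₗ[R] S) {x : M} (hx : x ∈ m) : isotypicProj R M S x = x :=
  isotypicProj_of_mem ((le_sSup ⟨inferInstance, ⟨e⟩⟩ : m ≤ isotypicPart R M S) hx)

theorem isotypicProj_of_mem_simple_of_not [IsSemisimpleModule R M] {m : Submodule R M}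
    [IsSimpleModule R m] (h : ¬ Nonempty (m ≃ₗ[R] S)) {x : M} (hx : x ∈ m) :
    isotypicProj R M S x = 0 :=
  isotypicProj_of_mem_anti ((le_sSup ⟨inferInstance, h⟩ : m ≤ antiIsotypicPart R M S) hx)

/-- A semisimple module is simple if its nonzero endomorphisms are surjective. -/
theorem isSimpleModule_of_end [IsSemisimpleModule R M] [Nontrivial M]
    (h : ∀ φ : M →ₗ[R] M, φ = 0 ∨ Function.Surjective φ) : IsSimpleModule R M := by
  have : IsSimpleOrder (Submodule R M) := by
    refine ⟨fun U => ?_⟩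
    obtain ⟨V, hUV⟩ := exists_isCompl U
    -- `U` is the range of this endomorphism, which is zero or surjective.
    rcases h (U.projection V hUV) with h0 | h0
    · left
      rw [← Submodule.range_projection hUV, h0, LinearMap.range_zero]
    · right
      rw [← Submodule.range_projection hUV, LinearMap.range_eq_top.2 h0]
  exact ⟨⟩

end IsotypicNaturality

/-! ### Letters on the columns of a diagram -/

/-- The largest element of a set of naturals is at least the number of the other elements, which
gives both claims by induction on the maximum. -/
theorem sum_range_card_le (A : Finset ℕ) :
    ∑ x ∈ Finset.range A.card, x ≤ ∑ x ∈ A, x ∧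
      (∑ x ∈ A, x = ∑ x ∈ Finset.range A.card, x → A = Finset.range A.card) := by
  induction A using Finset.induction_on_max with
  | empty => simp
  | insert a s h ih =>
    have ha : a ∉ s := fun hs => (h a hs).false
    have hc : s.card ≤ a := by
      have := Finset.card_le_card (fun x hx => Finset.mem_range.2 (h x hx) : s ⊆ Finset.range a)
      simpa using this
    rw [Finset.card_insert_of_notMem ha, Finset.sum_insert ha, Finset.sum_range_succ]
    refine ⟨by omega, fun heq => ?_⟩
    have h1 : a = s.card := by omega
    have h2 : s = Finset.range s.card := ih.2 (by omega)
    rw [Finset.range_add_one, ← h2, ← h1]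

/-- The sum of the row indices of the boxes of a diagram. -/
def rowSum (lam : YoungDiagram) : ℕ := ∑ c ∈ lam.cells, c.1

theorem sum_col_fst (lam : YoungDiagram) (j : ℕ) :
    ∑ c ∈ lam.col j, c.1 = ∑ x ∈ Finset.range (lam.colLen j), x := by
  rw [YoungDiagram.col_eq_prod, Finset.sum_product]
  simp

theorem sum_cells_eq (lam : YoungDiagram) (f : ℕ × ℕ → ℕ) :
    ∑ c ∈ lam.cells, f c = ∑ j ∈ lam.cells.image Prod.snd, ∑ c ∈ lam.col j, f c :=
  (Finset.sum_fiberwise_of_maps_to (fun _ hc => Finset.mem_image_of_mem _ hc) f).symm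

/-- In each column `f` takes `colLen` distinct values, with sum at least `0 + 1 + ⋯ + (colLen - 1)`.
Equality of the totals forces equality in every column, where the values of `f` are then the row
indices in some order. -/
theorem rowSum_le_of_injective_on_columns (lam : YoungDiagram) (f : ℕ × ℕ → ℕ)
    (hf : ∀ c ∈ lam.cells, ∀ c' ∈ lam.cells, c.2 = c'.2 → f c = f c' → c = c') :
    rowSum lam ≤ ∑ c ∈ lam.cells, f c ∧
      (∑ c ∈ lam.cells, f c = rowSum lam → ∀ c ∈ lam.cells, (f c, c.2) ∈ lam.cells) := by
  have hinj : ∀ j, Set.InjOn f (lam.col j) := by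
    intro j c hc c' hc' h
    rw [SetLike.mem_coe, YoungDiagram.mem_col_iff] at hc hc'
    exact hf c hc.1 c' hc'.1 (hc.2.trans hc'.2.symm) h
  have hcard : ∀ j, ((lam.col j).image f).card = lam.colLen j := fun j => by
    rw [Finset.card_image_of_injOn (hinj j), YoungDiagram.colLen_eq_card]
  have hsum : ∀ j, ∑ c ∈ lam.col j, f c = ∑ x ∈ (lam.col j).image f, x := fun j =>
    (Finset.sum_image (f := fun x => x) (hinj j)).symm
  have hle : ∀ j ∈ lam.cells.image Prod.snd, ∑ c ∈ lam.col j, c.1 ≤ ∑ c ∈ lam.col j, f c := by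
    intro j _
    rw [sum_col_fst, hsum, ← hcard]
    exact (sum_range_card_le _).1
  unfold rowSum
  rw [sum_cells_eq, sum_cells_eq]
  refine ⟨Finset.sum_le_sum hle, fun heq c hc => ?_⟩
  have hj := (Finset.sum_eq_sum_iff_of_le hle).1 heq.symm c.2 (Finset.mem_image_of_mem _ hc)
  rw [sum_col_fst, hsum, ← hcard] at hj
  have himg := (sum_range_card_le _).2 hj.symm
  have hm : f c ∈ (lam.col c.2).image f :=
    Finset.mem_image_of_mem _ (YoungDiagram.mem_col_iff.2 ⟨hc, rfl⟩)
  rw [himg, hcard, Finset.mem_range] at hm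
  exact YoungDiagram.mem_iff_lt_colLen.2 hm

/-- The sum of the letters of a word. -/
def letterSum {n : ℕ} (w : Word n) : ℕ := ∑ k, (w k : ℕ)

theorem letterSum_perm {n : ℕ} (w : Word n) (σ : Perm (Fin n)) :
    letterSum (fun k => w (σ k)) = letterSum w :=
  Equiv.sum_comp σ fun k => (w k : ℕ)

/-! ### Column stabilizers and words with distinct letters on each column -/

section Tableaux

variable {n : ℕ} {lam : PartitionOf n}

theorem letterSum_tableauWord (T : Tableau lam) : letterSum (tableauWord T) = rowSum lam.1 := by
  unfold letterSum rowSum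
  rw [← Equiv.sum_comp T, ← Finset.sum_coe_sort lam.1.cells]
  simp [tableauWord]

theorem nonempty_tableau (lam : PartitionOf n) : Nonempty (Tableau lam) :=
  ⟨Finset.equivFinOfCardEq lam.2⟩

theorem mem_colStab {T : Tableau lam} {σ : Perm (Fin n)} :
    σ ∈ colStab T ↔ ∀ k, (T.symm (σ k)).1.2 = (T.symm k).1.2 := by
  simp [colStab]

theorem one_mem_colStab (T : Tableau lam) : 1 ∈ colStab T := by
  simp [mem_colStab]

theorem mul_mem_colStab {T : Tableau lam} {σ τ : Perm (Fin n)} (hσ : σ ∈ colStab T)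
    (hτ : τ ∈ colStab T) : σ * τ ∈ colStab T := by
  rw [mem_colStab] at *
  intro k
  rw [Perm.mul_apply, hσ, hτ]

theorem inv_mem_colStab {T : Tableau lam} {σ : Perm (Fin n)} (hσ : σ ∈ colStab T) :
    σ⁻¹ ∈ colStab T := by
  rw [mem_colStab] at *
  intro k
  simpa using (hσ (σ⁻¹ k)).symm

theorem swap_mem_colStab {T : Tableau lam} {i j : Fin n}
    (h : (T.symm i).1.2 = (T.symm j).1.2) : swap i j ∈ colStab T := by
  rw [mem_colStab]
  intro k
  by_cases hi : k = i
  · subst hi; simp [h]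
  · by_cases hj : k = j
    · subst hj; simp [h]
    · rw [swap_apply_of_ne_of_ne hi hj]

/-- A word with distinct letters on each column of `T` has letter sum at least `rowSum lam`, and
equality holds only for the words of the column translates of `T`. -/
theorem rowSum_le_letterSum (T : Tableau lam) (w : Word n)
    (hw : ∀ i j, (T.symm i).1.2 = (T.symm j).1.2 → w i = w j → i = j) :
    rowSum lam.1 ≤ letterSum w ∧
      (letterSum w = rowSum lam.1 → ∃ σ ∈ colStab T, w = tableauWord (T.trans σ)) := by
  classical
  set f : ℕ × ℕ → ℕ := fun c => if h : c ∈ lam.1.cells then (w (T ⟨c, h⟩) : ℕ) else 0 with hfdef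
  have hfT : ∀ c : lam.1.cells, f c = w (T c) := fun c => by simp [hfdef]
  have hsum : ∑ c ∈ lam.1.cells, f c = letterSum w := by
    unfold letterSum
    rw [← Finset.sum_coe_sort, ← Equiv.sum_comp T]
    exact Finset.sum_congr rfl fun c _ => hfT c
  have hf := rowSum_le_of_injective_on_columns lam.1 f (by
    intro c hc c' hc' h2 h
    have h' : (w (T ⟨c, hc⟩) : ℕ) = w (T ⟨c', hc'⟩) := by
      rw [← hfT ⟨c, hc⟩, ← hfT ⟨c', hc'⟩]; exact h
    have := hw (T ⟨c, hc⟩) (T ⟨c', hc'⟩) (by simpa using h2) (Fin.ext h')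
    simpa using this)
  rw [hsum] at hf
  refine ⟨hf.1, fun heq => ?_⟩
  have hmem := hf.2 heq
  -- Each box moves within its column to the row named by its letter. This permutes the boxes, and
  -- transport along `T` gives a permutation of the entries.
  let ρ : lam.1.cells → lam.1.cells := fun c => ⟨(f c, c.1.2), hmem c c.2⟩
  have hρ : Function.Injective ρ := by
    intro c c' h
    have h1 : f c = f c' := congrArg (fun x => x.1.1) h
    have h2 : c.1.2 = c'.1.2 := congrArg (fun x => x.1.2) h
    rw [hfT, hfT] at h1
    exact T.injective (hw _ _ (by simpa using h2) (Fin.ext h1))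
  let ρ' : Perm lam.1.cells := Equiv.ofBijective ρ (Finite.injective_iff_bijective.1 hρ)
  let σ : Perm (Fin n) := (T.symm.trans ρ').trans T
  have hσ : ∀ k, T.symm (σ k) = ρ (T.symm k) := fun k => by simp [σ, ρ']
  -- The inverse appears because the box of `k` in `T.trans σ⁻¹` is `T.symm (σ k)`.
  refine ⟨σ⁻¹, inv_mem_colStab (mem_colStab.2 fun k => by rw [hσ]), ?_⟩
  funext k
  apply Fin.ext
  change (w k : ℕ) = (T.symm (σ k)).1.1
  rw [hσ]
  change (w k : ℕ) = f (T.symm k)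
  rw [hfT, apply_symm_apply]

end Tableaux

/-! ### Column antisymmetrizers -/

section Antisymmetrizer

variable {n : ℕ} {lam : PartitionOf n}

/-- The linear projection of `M^n` onto the span of the words with letter sum `s`. -/
def sumProj (n s : ℕ) : WordModule n →ₗ[GroupAlg n] WordModule n :=
  MonoidAlgebra.equivariantOfLinearOfComm
    (Finsupp.linearCombination ℂ fun w : Word n => if letterSum w = s then word w else 0) (by
      intro σ v
      induction v using Finsupp.induction_linear with
      | zero => simp
      | add f g hf hg => rw [smul_add, map_add, hf, hg, map_add, smul_add]
      | single w c =>
        have hc : (Finsupp.single w c : WordModule n) = c • word w := by simp [word]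
        rw [hc, smul_comm, LinearMap.map_smul _ c, LinearMap.map_smul _ c, smul_comm _ c,
          single_smul_word]
        congr 1
        simp only [word, Finsupp.linearCombination_single, one_smul]
        rw [letterSum_perm w σ⁻¹]
        split_ifs
        · exact (single_smul_word σ w).symm
        · simp)

theorem sumProj_word (s : ℕ) (w : Word n) :
    sumProj n s (word w) = if letterSum w = s then word w else 0 := by
  change Finsupp.linearCombination ℂ _ (word w) = _
  simp [word]

theorem linearMap_smul {V W : Type*} [AddCommMonoid V] [Module ℂ V] [Module (GroupAlg n) V]
    [IsScalarTower ℂ (GroupAlg n) V] [AddCommMonoid W] [Module ℂ W] [Module (GroupAlg n) W]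
    [IsScalarTower ℂ (GroupAlg n) W] (φ : V →ₗ[GroupAlg n] W) (c : ℂ) (v : V) :
    φ (c • v) = c • φ v :=
  (φ.restrictScalars ℂ).map_smul c v

/-- The column antisymmetrizer `∑_{σ ∈ C_T} sign(σ) σ`. -/
def antisym (T : Tableau lam) : GroupAlg n :=
  ∑ σ ∈ colStab T, ((Perm.sign σ : ℤ) : ℂ) • MonoidAlgebra.single σ 1

theorem antisym_smul_word (T : Tableau lam) :
    antisym T • word (tableauWord T) = polytabloid T := by
  unfold antisym polytabloid
  rw [Finset.sum_smul]
  refine Finset.sum_congr rfl fun σ _ => ?_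
  rw [smul_assoc, single_smul_word]
  rfl

theorem sign_mul_self (σ : Perm (Fin n)) :
    ((Perm.sign σ : ℤ) : ℂ) * ((Perm.sign σ : ℤ) : ℂ) = 1 := by
  rcases Int.units_eq_one_or (Perm.sign σ) with h | h <;> simp [h]

theorem antisym_mul_single {T : Tableau lam} {τ : Perm (Fin n)} (hτ : τ ∈ colStab T) :
    antisym T * MonoidAlgebra.single τ 1 = ((Perm.sign τ : ℤ) : ℂ) • antisym T := by
  unfold antisym
  rw [Finset.sum_mul, Finset.smul_sum]
  refine Finset.sum_bij' (fun σ _ => σ * τ) (fun σ _ => σ * τ⁻¹)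
    (fun σ hσ => mul_mem_colStab hσ hτ) (fun σ hσ => mul_mem_colStab hσ (inv_mem_colStab hτ))
    (fun σ _ => by simp) (fun σ _ => by simp) fun σ _ => ?_
  rw [smul_mul_assoc, MonoidAlgebra.single_mul_single, smul_smul, one_mul, Perm.sign_mul]
  congr 1
  push_cast
  rw [mul_left_comm, sign_mul_self, mul_one]

theorem antisym_smul_single_smul {V : Type*} [AddCommGroup V] [Module ℂ V] [Module (GroupAlg n) V]
    [IsScalarTower ℂ (GroupAlg n) V] {T : Tableau lam} {τ : Perm (Fin n)} (hτ : τ ∈ colStab T)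
    (v : V) : antisym T • (MonoidAlgebra.single τ 1 : GroupAlg n) • v =
      ((Perm.sign τ : ℤ) : ℂ) • antisym T • v := by
  rw [smul_smul, antisym_mul_single hτ, smul_assoc]

/-- Each term `sign(σ) σ` of the inner factor is absorbed by the outer one with total sign 1, once
for every element of `C_T`. -/
theorem antisym_smul_antisym_smul {V : Type*} [AddCommGroup V] [Module ℂ V]
    [Module (GroupAlg n) V] [IsScalarTower ℂ (GroupAlg n) V] (T : Tableau lam) (v : V) :
    antisym T • antisym T • v = ((colStab T).card : ℂ) • antisym T • v := by
  conv_lhs => enter [2]; unfold antisym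
  rw [Finset.sum_smul, Finset.smul_sum]
  have h : ∀ σ ∈ colStab T, antisym T • ((((Perm.sign σ : ℤ) : ℂ) • MonoidAlgebra.single σ 1 :
      GroupAlg n) • v) = antisym T • v := by
    intro σ hσ
    rw [← smul_assoc, smul_eq_mul, mul_smul_comm, antisym_mul_single hσ, smul_smul, sign_mul_self,
      one_smul]
  rw [Finset.sum_congr rfl h, Finset.sum_const, Nat.cast_smul_eq_nsmul]

theorem card_colStab_ne_zero (T : Tableau lam) : ((colStab T).card : ℂ) ≠ 0 :=
  Nat.cast_ne_zero.2 (Finset.card_ne_zero_of_mem (one_mem_colStab T))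

theorem antisym_smul_polytabloid (T : Tableau lam) :
    antisym T • polytabloid T = ((colStab T).card : ℂ) • polytabloid T := by
  rw [← antisym_smul_word, antisym_smul_antisym_smul]

/-- The transposition `(i j)` lies in `C_T` and fixes `w`, yet the antisymmetrizer absorbs it with
sign `-1`. -/
theorem antisym_smul_word_of_repeated (T : Tableau lam) {w : Word n} {i j : Fin n} (hij : i ≠ j)
    (hc : (T.symm i).1.2 = (T.symm j).1.2) (hw : w i = w j) : antisym T • word w = 0 := by
  have h := antisym_smul_single_smul (swap_mem_colStab hc) (word w)
  have hs : (fun k => w ((swap i j)⁻¹ k)) = w := by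
    funext k
    rw [swap_inv]
    by_cases hi : k = i
    · subst hi; simp [hw]
    · by_cases hj : k = j
      · subst hj; simp [hw]
      · rw [swap_apply_of_ne_of_ne hi hj]
  rw [single_smul_word, hs, Perm.sign_swap hij] at h
  simpa [self_eq_neg] using h

/-- A repeated letter in a column gives zero. Otherwise `rowSum_le_letterSum` applies, and in the
equality case `w` is a column translate of the word of `T`. -/
theorem antisym_smul_word_cases (T : Tableau lam) (w : Word n) :
    antisym T • word w = 0 ∨ rowSum lam.1 < letterSum w ∨
      (letterSum w = rowSum lam.1 ∧ ∃ σ : Perm (Fin n),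
        antisym T • word w = ((Perm.sign σ : ℤ) : ℂ) • polytabloid T) := by
  by_cases hw : ∀ i j, (T.symm i).1.2 = (T.symm j).1.2 → w i = w j → i = j
  · obtain ⟨h1, h2⟩ := rowSum_le_letterSum T w hw
    rcases h1.lt_or_eq with h | h
    · exact Or.inr (Or.inl h)
    · obtain ⟨σ, hσ, rfl⟩ := h2 h.symm
      refine Or.inr (Or.inr ⟨h.symm, σ, ?_⟩)
      rw [← antisym_smul_word, ← antisym_smul_single_smul hσ, single_smul_word]
      rfl
  · push Not at hw
    obtain ⟨i, j, hc, hl, hij⟩ := hw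
    exact Or.inl (antisym_smul_word_of_repeated T hij hc hl)

/-- The rank-one property behind Schur's lemma for `S^lam`. -/
theorem antisym_smul_sumProj_mem (T : Tableau lam) (v : WordModule n) :
    antisym T • sumProj n (rowSum lam.1) v ∈ Submodule.span ℂ {polytabloid T} := by
  induction v using Finsupp.induction_linear with
  | zero => simp
  | add f g hf hg => rw [map_add, smul_add]; exact Submodule.add_mem _ hf hg
  | single w c =>
    have hc : (Finsupp.single w c : WordModule n) = c • word w := by simp [word]
    rw [hc, linearMap_smul, smul_comm]
    refine Submodule.smul_mem _ _ ?_
    rw [sumProj_word]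
    split_ifs with h
    · rcases antisym_smul_word_cases T w with h0 | h0 | ⟨_, σ, h0⟩
      · rw [h0]; exact Submodule.zero_mem _
      · omega
      · rw [h0]; exact Submodule.smul_mem _ _ (Submodule.mem_span_singleton_self _)
    · rw [smul_zero]; exact Submodule.zero_mem _

theorem antisym_smul_sumProj_of_lt (T : Tableau lam) {s : ℕ} (hs : s < rowSum lam.1)
    (v : WordModule n) : antisym T • sumProj n s v = 0 := by
  induction v using Finsupp.induction_linear with
  | zero => simp
  | add f g hf hg => rw [map_add, smul_add, hf, hg, add_zero]
  | single w c =>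
    have hc : (Finsupp.single w c : WordModule n) = c • word w := by simp [word]
    rw [hc, linearMap_smul, smul_comm, sumProj_word]
    split_ifs with h
    · rcases antisym_smul_word_cases T w with h0 | h0 | ⟨h0, _⟩
      · rw [h0, smul_zero]
      · omega
      · omega
    · rw [smul_zero, smul_zero]

/-! ### Simplicity of the Specht modules -/

theorem polytabloid_mem (T : Tableau lam) : polytabloid T ∈ specht lam :=
  Submodule.subset_span ⟨T, rfl⟩

/-- Only the identity of `C_T` contributes: a column permutation that also keeps every entry in its
row is trivial. -/
theorem polytabloid_apply_tableauWord (T : Tableau lam) : polytabloid T (tableauWord T) = 1 := by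
  unfold polytabloid
  rw [Finsupp.finsetSum_apply, Finset.sum_eq_single_of_mem 1 (one_mem_colStab T)]
  · have : T.trans (1 : Perm (Fin n)) = T := rfl
    simp [word, this]
  · intro σ hσ hne
    have : tableauWord (T.trans σ) ≠ tableauWord T := by
      intro h
      apply hne
      have h' : σ⁻¹ = 1 := by
        ext1 k
        have h1 : (T.symm (σ⁻¹ k)).1.1 = (T.symm k).1.1 := congrArg Fin.val (congrFun h k)
        have h2 := mem_colStab.1 (inv_mem_colStab hσ) k
        exact T.symm.injective (Subtype.ext (Prod.ext h1 h2))
      simpa using h'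
    simp [word, this]

theorem polytabloid_ne_zero (T : Tableau lam) : polytabloid T ≠ 0 := fun h => by
  have := polytabloid_apply_tableauWord T
  simp [h] at this

theorem specht_induction {p : WordModule n → Prop} (poly : ∀ T : Tableau lam, p (polytabloid T))
    (zero : p 0) (add : ∀ x y, p x → p y → p (x + y)) (smul : ∀ (c : ℂ) x, p x → p (c • x))
    {x : WordModule n} (hx : x ∈ specht lam) : p x := by
  change x ∈ Submodule.span ℂ (Set.range fun T : Tableau lam => polytabloid T) at hx
  induction hx using Submodule.span_induction with
  | mem x hx => obtain ⟨T, rfl⟩ := hx; exact poly T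
  | zero => exact zero
  | add x y _ _ hx hy => exact add x y hx hy
  | smul a x _ hx => exact smul a x hx

theorem sumProj_polytabloid (T : Tableau lam) :
    sumProj n (rowSum lam.1) (polytabloid T) = polytabloid T := by
  rw [← antisym_smul_word, map_smul, sumProj_word, if_pos (letterSum_tableauWord T)]

theorem sumProj_of_mem {x : WordModule n} (hx : x ∈ specht lam) :
    sumProj n (rowSum lam.1) x = x :=
  specht_induction (p := fun x => sumProj n (rowSum lam.1) x = x) sumProj_polytabloid (map_zero _)
    (fun x y hx hy => by rw [map_add, hx, hy]) (fun c x hx => by rw [linearMap_smul, hx]) hx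

theorem exists_trans_eq (T T' : Tableau lam) : ∃ σ : Perm (Fin n), T' = T.trans σ :=
  ⟨T.symm.trans T', by ext; simp⟩

/-- A homomorphism on `S^lam` that multiplies one polytabloid by `c` is multiplication by `c`. -/
theorem eq_smul_of_eq_on_polytabloid (T : Tableau lam) (φ : specht lam →ₗ[GroupAlg n] WordModule n)
    (c : ℂ) (h : φ ⟨polytabloid T, polytabloid_mem T⟩ = c • polytabloid T) (x : specht lam) :
    φ x = c • (x : WordModule n) := by
  suffices ∃ hx, φ ⟨x, hx⟩ = c • (x : WordModule n) from this.2
  refine specht_induction (p := fun x => ∃ hx, φ ⟨x, hx⟩ = c • x) (fun T' => ⟨polytabloid_mem T', ?_⟩)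
    ⟨Submodule.zero_mem _, ?_⟩ (fun x y ⟨hx, h1⟩ ⟨hy, h2⟩ => ⟨Submodule.add_mem _ hx hy, ?_⟩)
    (fun a x ⟨hx, h1⟩ => ⟨Submodule.smul_of_tower_mem _ a hx, ?_⟩) x.2
  · obtain ⟨σ, rfl⟩ := exists_trans_eq T T'
    have : (⟨polytabloid (T.trans σ), polytabloid_mem _⟩ : specht lam) =
        (MonoidAlgebra.single σ 1 : GroupAlg n) • ⟨polytabloid T, polytabloid_mem T⟩ :=
      Subtype.ext (single_smul_polytabloid σ T).symm
    rw [this, map_smul, h, smul_comm, single_smul_polytabloid]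
  · rw [smul_zero]; exact map_zero φ
  · rw [smul_add, ← h1, ← h2, ← map_add]; rfl
  · rw [smul_comm, ← h1]; exact linearMap_smul φ a ⟨x, hx⟩

/-- A homomorphism from `S^lam` to `M^n`, followed by the projection on the words with the letter
sum of `S^lam`, is a scalar. -/
theorem exists_sumProj_hom_eq_smul (φ : specht lam →ₗ[GroupAlg n] WordModule n) :
    ∃ c : ℂ, ∀ x : specht lam, sumProj n (rowSum lam.1) (φ x) = c • (x : WordModule n) := by
  obtain ⟨T⟩ := nonempty_tableau lam
  let t : specht lam := ⟨polytabloid T, polytabloid_mem T⟩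
  let ψ := (sumProj n (rowSum lam.1)).comp φ
  have ht : antisym T • t = ((colStab T).card : ℂ) • t := Subtype.ext (antisym_smul_polytabloid T)
  -- The antisymmetrizer multiplies `t`, hence `ψ t`, by `|C_T|`. So `ψ t` lies on the line of
  -- `polytabloid T`, with the factor `|C_T|⁻¹ * c`.
  have h1 : ((colStab T).card : ℂ) • ψ t = antisym T • ψ t := by
    rw [← LinearMap.map_smul ψ (antisym T), ht, linearMap_smul]
  obtain ⟨c, hc⟩ := Submodule.mem_span_singleton.1 (antisym_smul_sumProj_mem T (φ t))
  refine ⟨((colStab T).card : ℂ)⁻¹ * c, eq_smul_of_eq_on_polytabloid T ψ _ ?_⟩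
  change ψ t = _
  rw [mul_smul, hc]
  change _ = _ • antisym T • ψ t
  rw [← h1, inv_smul_smul₀ (card_colStab_ne_zero T)]

/-- Projection to degree `rowSum lam` is the identity on `S^lam`. This form of Schur's lemma
precedes simplicity and yields it. -/
theorem exists_hom_eq_smul (φ : specht lam →ₗ[GroupAlg n] specht lam) :
    ∃ c : ℂ, ∀ x : specht lam, φ x = c • x := by
  obtain ⟨c, hc⟩ := exists_sumProj_hom_eq_smul ((specht lam).subtype.comp φ)
  refine ⟨c, fun x => Subtype.ext ?_⟩
  have h := hc x
  rwa [LinearMap.comp_apply, Submodule.subtype_apply, sumProj_of_mem (φ x).2] at h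

instance isSimpleModule_specht (lam : PartitionOf n) : IsSimpleModule (GroupAlg n) (specht lam) := by
  obtain ⟨T⟩ := nonempty_tableau lam
  have hnt : Nontrivial (specht lam) :=
    ⟨⟨⟨polytabloid T, polytabloid_mem T⟩, 0, fun h => polytabloid_ne_zero T (congrArg Subtype.val h)⟩⟩
  refine isSimpleModule_of_end fun φ => ?_
  obtain ⟨c, hc⟩ := exists_hom_eq_smul φ
  by_cases h0 : c = 0
  · left
    ext x
    rw [hc, h0, zero_smul, LinearMap.zero_apply]
  · right
    intro x
    exact ⟨c⁻¹ • x, by rw [hc, smul_inv_smul₀ h0]⟩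

end Antisymmetrizer

/-! ### Specht modules of different shapes are not isomorphic -/

section Distinct

variable {n : ℕ} {lam mu : PartitionOf n}

/-- If `rowSum mu` were smaller, the antisymmetrizer of a tableau of shape `lam` would kill `S^mu`,
whereas it acts on its own polytabloid by `|C_T| ≠ 0`. -/
theorem rowSum_le_of_equiv (e : specht lam ≃ₗ[GroupAlg n] specht mu) :
    rowSum lam.1 ≤ rowSum mu.1 := by
  by_contra! hlt
  obtain ⟨T⟩ := nonempty_tableau lam
  let t : specht lam := ⟨polytabloid T, polytabloid_mem T⟩
  have ht : antisym T • t = ((colStab T).card : ℂ) • t := Subtype.ext (antisym_smul_polytabloid T)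
  have h1 : ((colStab T).card : ℂ) • e t = antisym T • e t := by
    rw [← LinearEquiv.map_smul e (antisym T), ht]
    exact (linearMap_smul e.toLinearMap _ _).symm
  have h2 : antisym T • (e t : WordModule n) = 0 := by
    rw [← sumProj_of_mem (e t).2]
    exact antisym_smul_sumProj_of_lt T hlt _
  have h3 : antisym T • e t = 0 := Subtype.ext h2
  rw [h3, smul_eq_zero_iff_right (card_colStab_ne_zero T)] at h1
  have h4 : t = 0 := by simpa using h1
  exact polytabloid_ne_zero T (congrArg Subtype.val h4)

/-- The number of occurrences of the letter `i` is the length of row `i`. -/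
theorem eq_of_tableauWord_eq (T : Tableau lam) (T' : Tableau mu)
    (h : tableauWord T = tableauWord T') : lam = mu := by
  classical
  have hcard : ∀ {nu : PartitionOf n} (S : Tableau nu) (i : ℕ),
      nu.1.rowLen i = (Finset.univ.filter fun k => (tableauWord S k : ℕ) = i).card := by
    intro nu S i
    rw [YoungDiagram.rowLen_eq_card, YoungDiagram.row]
    symm
    refine Finset.card_bij (fun k _ => (S.symm k).1) ?_ ?_ ?_
    · intro k hk
      simp only [Finset.mem_filter, Finset.mem_univ, true_and] at hk
      exact Finset.mem_filter.2 ⟨(S.symm k).2, hk⟩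
    · intro a _ b _ hab
      exact S.symm.injective (Subtype.ext hab)
    · intro c hc
      rw [Finset.mem_filter] at hc
      refine ⟨S ⟨c, hc.1⟩, ?_, by simp⟩
      simp only [Finset.mem_filter, Finset.mem_univ, true_and]
      simp [tableauWord, hc.2]
  apply Subtype.ext
  ext ⟨i, j⟩
  rw [YoungDiagram.mem_cells, YoungDiagram.mem_cells, YoungDiagram.mem_iff_lt_rowLen,
    YoungDiagram.mem_iff_lt_rowLen, hcard T, hcard T', h]

theorem exists_tableauWord_of_mem {x : WordModule n} (hx : x ∈ specht lam) {w : Word n}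
    (hw : x w ≠ 0) : ∃ T : Tableau lam, w = tableauWord T := by
  by_contra! hne
  refine hw (specht_induction (p := fun x : WordModule n => x w = 0) (fun T => ?_) rfl ?_ ?_ hx)
  · unfold polytabloid
    rw [Finsupp.finsetSum_apply]
    refine Finset.sum_eq_zero fun σ _ => ?_
    simp [word, (hne (T.trans σ)).symm]
  · intro x y hx hy
    simp [hx, hy]
  · intro c x hx
    simp [hx]

/-- Once the row sums agree, the isomorphism is a nonzero scalar inside `M^n`. The two modules then
share a polytabloid, and a word in its support determines the shape. -/
theorem eq_of_equiv (e : specht lam ≃ₗ[GroupAlg n] specht mu) : lam = mu := by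
  have hs : rowSum mu.1 = rowSum lam.1 :=
    (rowSum_le_of_equiv e.symm).antisymm (rowSum_le_of_equiv e)
  obtain ⟨c, hc⟩ := exists_sumProj_hom_eq_smul ((specht mu).subtype.comp e.toLinearMap)
  obtain ⟨T⟩ := nonempty_tableau lam
  let t : specht lam := ⟨polytabloid T, polytabloid_mem T⟩
  have h1 : (e t : WordModule n) = c • polytabloid T := by
    have h := hc t
    rw [← hs] at h
    exact (sumProj_of_mem (e t).2).symm.trans h
  have hc0 : c ≠ 0 := by
    rintro rfl
    rw [zero_smul] at h1
    have h4 : t = 0 := by simpa using (Subtype.ext h1 : e t = 0)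
    exact polytabloid_ne_zero T (congrArg Subtype.val h4)
  obtain ⟨T', hT'⟩ := exists_tableauWord_of_mem (e t).2 (w := tableauWord T) (by
    rw [h1, Finsupp.smul_apply, polytabloid_apply_tableauWord]
    simpa using hc0)
  exact eq_of_tableauWord_eq T T' hT'

theorem isotypicProj_of_mem_specht {x : WordModule n} (hx : x ∈ specht lam) :
    isotypicProj (GroupAlg n) (WordModule n) (specht lam) x = x :=
  isotypicProj_of_mem_simple (LinearEquiv.refl _ _) hx

theorem isotypicProj_of_mem_specht_of_ne (h : lam ≠ mu) {x : WordModule n} (hx : x ∈ specht lam) :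
    isotypicProj (GroupAlg n) (WordModule n) (specht mu) x = 0 :=
  isotypicProj_of_mem_simple_of_not (fun ⟨e⟩ => h (eq_of_equiv e)) hx

/-- On the words with the letter sum of `S^lam`, the isotypic projection maps to `S^lam`. -/
theorem isotypicProj_mem_specht {v : WordModule n} (hv : sumProj n (rowSum lam.1) v = v) :
    isotypicProj (GroupAlg n) (WordModule n) (specht lam) v ∈ specht lam := by
  rw [← hv, isotypicProj_map]
  -- On any copy of `S^lam` in `M^n`, the degree projection is a scalar multiple of the isomorphism
  -- with `S^lam`, so it lands in `S^lam`.
  have hle : (isotypicPart (GroupAlg n) (WordModule n) (specht lam)).map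
      (sumProj n (rowSum lam.1)) ≤ specht lam := by
    rw [Submodule.map_le_iff_le_comap]
    refine sSup_le fun m hm x hx => ?_
    obtain ⟨-, ⟨e⟩⟩ := hm
    obtain ⟨c, hc⟩ := exists_sumProj_hom_eq_smul (m.subtype.comp e.symm.toLinearMap)
    have h := hc (e ⟨x, hx⟩)
    simp only [LinearMap.comp_apply, LinearEquiv.coe_coe, LinearEquiv.symm_apply_apply,
      Submodule.subtype_apply] at h
    rw [Submodule.mem_comap, h]
    exact Submodule.smul_of_tower_mem _ c (Subtype.property _)
  exact hle (Submodule.mem_map_of_mem (isotypicProj_mem v))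

end Distinct

/-! ### The inclusion of symmetric groups -/

section Inclusion

variable {n : ℕ}

@[simp]
theorem inclPerm_castSucc (σ : Perm (Fin n)) (i : Fin n) :
    inclPerm σ i.castSucc = (σ i).castSucc :=
  Perm.viaEmbedding_apply σ Fin.castSuccEmb i

@[simp]
theorem inclPerm_last (σ : Perm (Fin n)) : inclPerm σ (Fin.last n) = Fin.last n :=
  Perm.viaEmbedding_apply_of_notMem _ _ _ (by
    rintro ⟨i, hi⟩
    exact (Fin.castSucc_lt_last i).ne hi)

theorem inclPerm_inv (σ : Perm (Fin n)) : inclPerm σ⁻¹ = (inclPerm σ)⁻¹ :=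
  map_inv (Perm.viaEmbeddingHom Fin.castSuccEmb) σ

theorem sign_inclPerm (σ : Perm (Fin n)) : Perm.sign (inclPerm σ) = Perm.sign σ := by
  unfold inclPerm Perm.viaEmbedding
  convert Perm.sign_extendDomain σ (Equiv.ofInjective Fin.castSuccEmb.1 Fin.castSuccEmb.2)

theorem inclPerm_swap (i j : Fin n) :
    inclPerm (swap i j) = swap i.castSucc j.castSucc := by
  ext k
  induction k using Fin.lastCases with
  | last =>
    rw [inclPerm_last, swap_apply_of_ne_of_ne (Fin.castSucc_lt_last i).ne'
      (Fin.castSucc_lt_last j).ne']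
  | cast k =>
    rw [inclPerm_castSucc, ← (Fin.castSucc_injective n).map_swap]

theorem exists_inclPerm_eq {τ : Perm (Fin (n + 1))} (h : τ (Fin.last n) = Fin.last n) :
    ∃ ρ : Perm (Fin n), inclPerm ρ = τ := by
  have key : ∀ i : Fin n, ∃ j : Fin n, j.castSucc = τ i.castSucc := fun i =>
    Fin.exists_castSucc_eq.2 fun hi =>
      (Fin.castSucc_lt_last i).ne (τ.injective (hi.trans h.symm))
  choose g hg using key
  have hinj : Function.Injective g := fun i j hij => by
    have : τ i.castSucc = τ j.castSucc := by rw [← hg, ← hg, hij]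
    exact Fin.castSucc_injective n (τ.injective this)
  refine ⟨Equiv.ofBijective g (Finite.injective_iff_bijective.1 hinj), ?_⟩
  ext k
  induction k using Fin.lastCases with
  | last => rw [inclPerm_last, h]
  | cast k => rw [inclPerm_castSucc, Equiv.ofBijective_apply, hg]

/-- The inclusion `ℂ[S_n] → ℂ[S_{n+1}]`. -/
def inclAlg (n : ℕ) : GroupAlg n →ₐ[ℂ] GroupAlg (n + 1) :=
  MonoidAlgebra.mapDomainAlgHom ℂ ℂ (Perm.viaEmbeddingHom (Fin.castSuccEmb (n := n)))

theorem inclAlg_single (σ : Perm (Fin n)) (c : ℂ) :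
    inclAlg n (MonoidAlgebra.single σ c) = MonoidAlgebra.single (inclPerm σ) c := by
  simp [inclAlg, inclPerm, Perm.viaEmbeddingHom_apply]

/-- A linear map that is equivariant for the symmetric group is linear over the group algebra. -/
theorem map_groupAlg_smul {V : Type*} [AddCommMonoid V] [Module ℂ V] [Module (GroupAlg n) V]
    [IsScalarTower ℂ (GroupAlg n) V] (f : V →ₗ[ℂ] WordModule (n + 1))
    (hf : ∀ (σ : Perm (Fin n)) v, f ((MonoidAlgebra.single σ 1 : GroupAlg n) • v) =
      (MonoidAlgebra.single (inclPerm σ) 1 : GroupAlg (n + 1)) • f v) (r : GroupAlg n) (v : V) :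
    f (r • v) = inclAlg n r • f v := by
  induction r using MonoidAlgebra.induction_linear with
  | zero => rw [zero_smul, map_zero, map_zero]; exact (zero_smul (GroupAlg (n + 1)) (f v)).symm
  | add a b ha hb => rw [add_smul, map_add, ha, hb, map_add, add_smul]
  | single σ c =>
    have hc : (MonoidAlgebra.single σ c : GroupAlg n) = c • MonoidAlgebra.single σ 1 := by simp
    rw [hc, smul_assoc, map_smul, hf, map_smul, smul_assoc, inclAlg_single]

/-- The kernel of a linear map that is equivariant for the symmetric group. -/
def equivariantKer {V : Type*} [AddCommMonoid V] [Module ℂ V] [Module (GroupAlg n) V]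
    [IsScalarTower ℂ (GroupAlg n) V] (f : V →ₗ[ℂ] WordModule (n + 1))
    (hf : ∀ (σ : Perm (Fin n)) v, f ((MonoidAlgebra.single σ 1 : GroupAlg n) • v) =
      (MonoidAlgebra.single (inclPerm σ) 1 : GroupAlg (n + 1)) • f v) :
    Submodule (GroupAlg n) V where
  carrier := {v | f v = 0}
  add_mem' {a b} ha hb := by
    simp only [Set.mem_ofPred_eq] at *
    rw [map_add, ha, hb, add_zero]
  zero_mem' := map_zero f
  smul_mem' r v hv := by
    simp only [Set.mem_ofPred_eq] at *
    rw [map_groupAlg_smul f hf, hv, smul_zero]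

/-! ### The adding operators -/

theorem adding_word (a : Fin (n + 1)) (w : Word n) :
    adding a (word w) = word (Fin.snoc (fun k => (w k).castSucc) a : Word (n + 1)) := by
  simp [adding, word, Finsupp.mapDomain_single]

theorem adding_smul (a : Fin (n + 1)) (σ : Perm (Fin n)) (v : WordModule n) :
    adding a ((MonoidAlgebra.single σ 1 : GroupAlg n) • v) =
      (MonoidAlgebra.single (inclPerm σ) 1 : GroupAlg (n + 1)) • adding a v := by
  induction v using Finsupp.induction_linear with
  | zero => simp
  | add f g hf hg => rw [smul_add, map_add, hf, hg, map_add, smul_add]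
  | single w c =>
    have hc : (Finsupp.single w c : WordModule n) = c • word w := by simp [word]
    rw [hc, smul_comm, LinearMap.map_smul _ c, LinearMap.map_smul _ c, smul_comm _ c, single_smul_word, adding_word,
      adding_word, single_smul_word]
    congr 2
    funext k
    rw [← inclPerm_inv]
    induction k using Fin.lastCases with
    | last => simp
    | cast k => simp

theorem sumProj_adding (a : Fin (n + 1)) (s : ℕ) (v : WordModule n) :
    sumProj (n + 1) (s + a) (adding a v) = adding a (sumProj n s v) := by
  induction v using Finsupp.induction_linear with
  | zero => simp
  | add f g hf hg => simp only [map_add, hf, hg]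
  | single w c =>
    have hc : (Finsupp.single w c : WordModule n) = c • word w := by simp [word]
    rw [hc, map_smul, linearMap_smul, linearMap_smul, map_smul, adding_word, sumProj_word,
      sumProj_word]
    have hl : letterSum (Fin.snoc (fun k => (w k).castSucc) a : Word (n + 1)) =
        letterSum w + a := by
      unfold letterSum
      rw [Fin.sum_univ_castSucc]
      simp
    rw [hl]
    by_cases h : letterSum w = s
    · rw [if_pos h, if_pos (by rw [h]), adding_word]
    · rw [if_neg h, if_neg (by omega), map_zero]

end Inclusion

/-! ### The lifting operators -/

section Lifting

variable {n : ℕ} {lam : PartitionOf n} {mu : PartitionOf (n + 1)}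

/-- The box of `mu` that is not in `lam`. -/
def addedBox (h : lam.1 ≤ mu.1) : ℕ × ℕ := (exists_addedBox h).choose

theorem cells_sdiff_eq (h : lam.1 ≤ mu.1) : mu.1.cells \ lam.1.cells = {addedBox h} :=
  (exists_addedBox h).choose_spec

theorem addedRow_val (h : lam.1 ≤ mu.1) : (addedRow h : ℕ) = (addedBox h).1 := rfl

theorem addedBox_mem (h : lam.1 ≤ mu.1) : addedBox h ∈ mu.1.cells :=
  (Finset.mem_sdiff.1 (cells_sdiff_eq h ▸ Finset.mem_singleton_self _)).1

theorem addedBox_notMem (h : lam.1 ≤ mu.1) : addedBox h ∉ lam.1.cells :=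
  (Finset.mem_sdiff.1 (cells_sdiff_eq h ▸ Finset.mem_singleton_self _)).2

theorem mem_or_eq_addedBox (h : lam.1 ≤ mu.1) {c : ℕ × ℕ} (hc : c ∈ mu.1.cells) :
    c ∈ lam.1.cells ∨ c = addedBox h := by
  by_cases hl : c ∈ lam.1.cells
  · exact Or.inl hl
  · exact Or.inr (Finset.mem_singleton.1 (cells_sdiff_eq h ▸ Finset.mem_sdiff.2 ⟨hc, hl⟩))

theorem cells_eq_insert (h : lam.1 ≤ mu.1) :
    mu.1.cells = insert (addedBox h) lam.1.cells := by
  ext c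
  rw [Finset.mem_insert]
  constructor
  · intro hc
    exact (mem_or_eq_addedBox h hc).symm
  · rintro (rfl | hc)
    · exact addedBox_mem h
    · exact YoungDiagram.cells_subset_iff.2 h hc

theorem rowSum_eq_add (h : lam.1 ≤ mu.1) : rowSum mu.1 = rowSum lam.1 + addedRow h := by
  unfold rowSum
  rw [cells_eq_insert h, Finset.sum_insert (addedBox_notMem h), addedRow_val, add_comm]

/-- The box of the extended tableau with a given entry. -/
def extBox (h : lam.1 ≤ mu.1) (T : Tableau lam) : Fin (n + 1) → mu.1.cells :=
  Fin.lastCases ⟨addedBox h, addedBox_mem h⟩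
    fun i => ⟨(T.symm i).1, YoungDiagram.cells_subset_iff.2 h (T.symm i).2⟩

theorem extBox_injective (h : lam.1 ≤ mu.1) (T : Tableau lam) :
    Function.Injective (extBox h T) := by
  intro i j hij
  have hne : ∀ k : Fin n, (T.symm k).1 ≠ addedBox h := fun k hk =>
    addedBox_notMem h (hk ▸ (T.symm k).2)
  induction i using Fin.lastCases with
  | last =>
    induction j using Fin.lastCases with
    | last => rfl
    | cast j => simp [extBox] at hij; exact absurd hij.symm (hne j)
  | cast i =>
    induction j using Fin.lastCases with
    | last => simp [extBox] at hij; exact absurd hij (hne i)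
    | cast j =>
      simp only [extBox, Fin.lastCases_castSucc, Subtype.mk.injEq] at hij
      rw [T.symm.injective (Subtype.ext hij)]

/-- The tableau of shape `mu` obtained from `T` by putting the entry `n + 1` in the added box. -/
def extTableau (h : lam.1 ≤ mu.1) (T : Tableau lam) : Tableau mu :=
  (Equiv.ofBijective (extBox h T)
    ((Fintype.bijective_iff_injective_and_card _).2 ⟨extBox_injective h T, by
      rw [Fintype.card_fin, Fintype.card_coe]; exact mu.2.symm⟩)).symm

theorem extTableau_symm_castSucc (h : lam.1 ≤ mu.1) (T : Tableau lam) (i : Fin n) :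
    ((extTableau h T).symm i.castSucc).1 = (T.symm i).1 := by
  simp [extTableau, extBox]

theorem extTableau_symm_last (h : lam.1 ≤ mu.1) (T : Tableau lam) :
    ((extTableau h T).symm (Fin.last n)).1 = addedBox h := by
  simp [extTableau, extBox]

theorem adding_tableauWord (h : lam.1 ≤ mu.1) (T : Tableau lam) :
    adding (addedRow h) (word (tableauWord T)) = word (tableauWord (extTableau h T)) := by
  rw [adding_word]
  congr 1
  funext k
  apply Fin.ext
  induction k using Fin.lastCases with
  | last => simp [tableauWord, extTableau_symm_last, addedRow_val]
  | cast k => simp [tableauWord, extTableau_symm_castSucc]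

theorem inclPerm_mem_colStab (h : lam.1 ≤ mu.1) {T : Tableau lam} {σ : Perm (Fin n)}
    (hσ : σ ∈ colStab T) : inclPerm σ ∈ colStab (extTableau h T) := by
  rw [mem_colStab] at *
  intro k
  induction k using Fin.lastCases with
  | last => rw [inclPerm_last]
  | cast k => rw [inclPerm_castSucc, extTableau_symm_castSucc, extTableau_symm_castSucc, hσ]

/-- `C_T` embeds in the column stabilizer of the extended tableau, so the larger antisymmetrizer
absorbs every term of the smaller one. This is what shows that the lifting is not zero. -/
theorem antisym_smul_adding_polytabloid (h : lam.1 ≤ mu.1) (T : Tableau lam) :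
    antisym (extTableau h T) • adding (addedRow h) (polytabloid T) =
      ((colStab T).card : ℂ) • polytabloid (extTableau h T) := by
  rw [← antisym_smul_word T]
  conv_lhs => enter [2, 2]; unfold antisym
  rw [Finset.sum_smul, map_sum, Finset.smul_sum, Nat.cast_smul_eq_nsmul, ← Finset.sum_const]
  refine Finset.sum_congr rfl fun σ hσ => ?_
  rw [smul_assoc, map_smul, adding_smul, smul_comm,
    antisym_smul_single_smul (inclPerm_mem_colStab h hσ), sign_inclPerm, smul_smul, sign_mul_self,
    one_smul, adding_tableauWord, antisym_smul_word]

theorem lifting_apply (h : lam.1 ≤ mu.1) (v : specht lam) :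
    lifting h v = isotypicProj (GroupAlg (n + 1)) (WordModule (n + 1)) (specht mu)
      (adding (addedRow h) v) := rfl

theorem lifting_smul (h : lam.1 ≤ mu.1) (σ : Perm (Fin n)) (v : specht lam) :
    lifting h ((MonoidAlgebra.single σ 1 : GroupAlg n) • v) =
      (MonoidAlgebra.single (inclPerm σ) 1 : GroupAlg (n + 1)) • lifting h v := by
  rw [lifting_apply, lifting_apply, ← map_smul, ← adding_smul]
  rfl

/-- By `rowSum_eq_add` and `sumProj_adding`, the appended vector has exactly the degree of `S^mu`,
where the isotypic projection takes values in `S^mu`. -/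
theorem lifting_mem (h : lam.1 ≤ mu.1) (v : specht lam) : lifting h v ∈ specht mu := by
  rw [lifting_apply]
  apply isotypicProj_mem_specht
  rw [rowSum_eq_add h, sumProj_adding, sumProj_of_mem v.2]

/-- By equivariance the kernel is a submodule of the simple module `S^lam`. It is not everything,
since applying the antisymmetrizer of the extended tableau to the lift of `polytabloid T` gives a
nonzero vector. -/
theorem lifting_injective (h : lam.1 ≤ mu.1) : Function.Injective (lifting h) := by
  have hs := (isSimpleModule_iff (GroupAlg n) (specht lam)).1 inferInstance
  rcases hs.eq_bot_or_eq_top (equivariantKer (lifting h) (lifting_smul h)) with hk | hk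
  · rw [injective_iff_map_eq_zero]
    intro v hv
    have : v ∈ equivariantKer (lifting h) (lifting_smul h) := hv
    rwa [hk, Submodule.mem_bot] at this
  · obtain ⟨T⟩ := nonempty_tableau lam
    have h0 : lifting h ⟨polytabloid T, polytabloid_mem T⟩ = 0 := by
      change _ ∈ equivariantKer (lifting h) (lifting_smul h)
      rw [hk]; trivial
    have h1 := congrArg (fun x => antisym (extTableau h T) • x) h0
    simp only [smul_zero] at h1
    rw [lifting_apply, ← map_smul, antisym_smul_adding_polytabloid, linearMap_smul,
      isotypicProj_of_mem_specht (polytabloid_mem _)] at h1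
    exact absurd h1 (smul_ne_zero (card_colStab_ne_zero T) (polytabloid_ne_zero _))

end Lifting

/-! ### Young's lattice -/

section YoungLattice

variable {n : ℕ}

theorem col_lt_card {lam : YoungDiagram} {c : ℕ × ℕ} (hc : c ∈ lam.cells) : c.2 < lam.card := by
  have h : c.2 < lam.rowLen c.1 := YoungDiagram.mem_iff_lt_rowLen.1 hc
  rw [YoungDiagram.rowLen_eq_card] at h
  exact h.trans_le (Finset.card_le_card (Finset.filter_subset _ _))

instance finite_partitionOf : Finite (PartitionOf n) := by
  let g : PartitionOf n → (Finset.range n ×ˢ Finset.range n).powerset := fun lam =>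
    ⟨lam.1.cells, Finset.mem_powerset.2 fun c hc => Finset.mem_product.2
      ⟨Finset.mem_range.2 ((row_lt_card hc).trans_eq lam.2),
        Finset.mem_range.2 ((col_lt_card hc).trans_eq lam.2)⟩⟩
  refine Finite.of_injective g fun lam mu h => Subtype.ext (YoungDiagram.ext ?_)
  exact congrArg Subtype.val h

instance fintypePartitionOf : Fintype (PartitionOf n) := Fintype.ofFinite _

/-- The diagrams obtained from `lam` by adding a box. -/
def upSet (lam : PartitionOf n) : Finset (PartitionOf (n + 1)) := by
  classical exact Finset.univ.filter fun mu => lam.1 ≤ mu.1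

/-- The diagrams obtained from `mu` by removing a box. -/
def downSet (mu : PartitionOf (n + 1)) : Finset (PartitionOf n) := by
  classical exact Finset.univ.filter fun lam => lam.1 ≤ mu.1

theorem mem_upSet {lam : PartitionOf n} {mu : PartitionOf (n + 1)} :
    mu ∈ upSet lam ↔ lam.1 ≤ mu.1 := by simp [upSet]

theorem mem_downSet {lam : PartitionOf n} {mu : PartitionOf (n + 1)} :
    lam ∈ downSet mu ↔ lam.1 ≤ mu.1 := by simp [downSet]

theorem addedBox_eq_of_upper {lam : PartitionOf n} {mu : PartitionOf (n + 1)} (h : lam.1 ≤ mu.1) :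
    (addedBox h).2 = lam.1.rowLen (addedBox h).1 := by
  have h1 : ¬ (addedBox h).2 < lam.1.rowLen (addedBox h).1 := fun hlt =>
    addedBox_notMem h (YoungDiagram.mem_iff_lt_rowLen.2 hlt)
  by_contra hne
  have hm : ((addedBox h).1, lam.1.rowLen (addedBox h).1) ∈ mu.1.cells :=
    mu.1.up_left_mem le_rfl (by omega : _ ≤ (addedBox h).2) (addedBox_mem h)
  rcases mem_or_eq_addedBox h hm with h2 | h2
  · exact (YoungDiagram.mem_iff_lt_rowLen.1 h2).false
  · exact hne (congrArg Prod.snd h2).symm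

theorem addable_addedBox {lam : PartitionOf n} {mu : PartitionOf (n + 1)} (h : lam.1 ≤ mu.1) :
    (addedBox h).1 = 0 ∨
      lam.1.rowLen (addedBox h).1 < lam.1.rowLen ((addedBox h).1 - 1) := by
  by_cases h0 : (addedBox h).1 = 0
  · exact Or.inl h0
  · right
    have hm : ((addedBox h).1 - 1, (addedBox h).2) ∈ mu.1.cells :=
      mu.1.up_left_mem (Nat.sub_le _ _) le_rfl (addedBox_mem h)
    rcases mem_or_eq_addedBox h hm with h2 | h2
    · rw [← addedBox_eq_of_upper h]
      exact YoungDiagram.mem_iff_lt_rowLen.1 h2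
    · have := congrArg Prod.fst h2
      simp only at this
      omega

theorem exists_up (lam : PartitionOf n) {i : ℕ}
    (hi : i = 0 ∨ lam.1.rowLen i < lam.1.rowLen (i - 1)) :
    ∃ (mu : PartitionOf (n + 1)) (h : lam.1 ≤ mu.1), (addedBox h).1 = i := by
  have hnot : (i, lam.1.rowLen i) ∉ lam.1.cells := fun h =>
    (YoungDiagram.mem_iff_lt_rowLen.1 h).false
  let mu : YoungDiagram := ⟨insert (i, lam.1.rowLen i) lam.1.cells, by
    rintro ⟨a, b⟩ ⟨c, d⟩ ⟨hca, hdb⟩ hab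
    simp only [Finset.coe_insert, Set.mem_insert_iff, Prod.mk.injEq, Finset.mem_coe] at hab ⊢
    simp only at hca hdb
    rcases hab with ⟨rfl, rfl⟩ | hab
    · by_cases hc : c = a
      · subst hc
        rcases hdb.lt_or_eq with hd | hd
        · exact Or.inr (YoungDiagram.mem_iff_lt_rowLen.2 hd)
        · exact Or.inl ⟨rfl, hd⟩
      · right
        refine YoungDiagram.mem_iff_lt_rowLen.2 ?_
        have := lam.1.rowLen_anti c (a - 1) (by omega)
        omega
    · exact Or.inr (lam.1.up_left_mem hca hdb hab)⟩
  have hle : lam.1 ≤ mu := YoungDiagram.cells_subset_iff.1 (Finset.subset_insert _ _)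
  have hcard : mu.card = n + 1 :=
    (Finset.card_insert_of_notMem hnot).trans (congrArg (· + 1) lam.2)
  refine ⟨⟨mu, hcard⟩, hle, ?_⟩
  have hm : (i, lam.1.rowLen i) ∈ mu.cells := Finset.mem_insert_self _ _
  rcases mem_or_eq_addedBox (mu := ⟨mu, hcard⟩) hle hm with h | h
  · exact absurd h hnot
  · rw [← h]

theorem removable_addedBox {kap : PartitionOf n} {lam : PartitionOf (n + 1)} (h : kap.1 ≤ lam.1) :
    lam.1.rowLen (addedBox h).1 = (addedBox h).2 + 1 ∧
      lam.1.rowLen ((addedBox h).1 + 1) < lam.1.rowLen (addedBox h).1 := by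
  have h1 : (addedBox h).2 < lam.1.rowLen (addedBox h).1 :=
    YoungDiagram.mem_iff_lt_rowLen.1 (addedBox_mem h)
  -- The added box is a corner: a box of `kap` weakly below and to the right of it would force it
  -- into `kap`.
  have key : ∀ c ∈ lam.1.cells, (addedBox h).1 ≤ c.1 → (addedBox h).2 ≤ c.2 → c = addedBox h := by
    intro c hc hc1 hc2
    rcases mem_or_eq_addedBox h hc with h2 | h2
    · exact absurd (kap.1.up_left_mem hc1 hc2 h2) (addedBox_notMem h)
    · exact h2
  have h2 : ¬ (addedBox h).2 + 1 < lam.1.rowLen (addedBox h).1 := fun hlt => by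
    have := congrArg Prod.snd (key ((addedBox h).1, (addedBox h).2 + 1)
      (YoungDiagram.mem_iff_lt_rowLen.2 hlt) le_rfl (Nat.le_succ _))
    simp at this
  have h3 : ¬ (addedBox h).2 < lam.1.rowLen ((addedBox h).1 + 1) := fun hlt => by
    have := congrArg Prod.fst (key ((addedBox h).1 + 1, (addedBox h).2)
      (YoungDiagram.mem_iff_lt_rowLen.2 hlt) (Nat.le_succ _) le_rfl)
    simp at this
  omega

theorem exists_down (lam : PartitionOf (n + 1)) {i : ℕ}
    (hi : lam.1.rowLen (i + 1) < lam.1.rowLen i) :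
    ∃ (kap : PartitionOf n) (h : kap.1 ≤ lam.1), (addedBox h).1 = i := by
  have hmem : (i, lam.1.rowLen i - 1) ∈ lam.1.cells :=
    YoungDiagram.mem_iff_lt_rowLen.2 (by omega)
  let kap : YoungDiagram := ⟨lam.1.cells.erase (i, lam.1.rowLen i - 1), by
    rintro ⟨a, b⟩ ⟨c, d⟩ ⟨hca, hdb⟩ hab
    simp only [Finset.coe_erase, Set.mem_sdiff, Finset.mem_coe, Set.mem_singleton_iff,
      Prod.mk.injEq] at hab ⊢
    simp only at hca hdb
    refine ⟨lam.1.up_left_mem hca hdb hab.1, ?_⟩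
    rintro ⟨rfl, rfl⟩
    have h1 : b < lam.1.rowLen a := YoungDiagram.mem_iff_lt_rowLen.1 hab.1
    by_cases ha : a = c
    · subst ha
      exact hab.2 ⟨rfl, by omega⟩
    · have := lam.1.rowLen_anti (c + 1) a (by omega)
      omega⟩
  have hle : kap ≤ lam.1 := YoungDiagram.cells_subset_iff.1 (Finset.erase_subset _ _)
  have hcard : kap.card = n := by
    have h1 := Finset.card_erase_of_mem hmem
    have h2 : lam.1.cells.card = n + 1 := lam.2
    rw [h2] at h1
    exact h1
  refine ⟨⟨kap, hcard⟩, hle, ?_⟩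
  rcases mem_or_eq_addedBox (lam := ⟨kap, hcard⟩) hle hmem with h | h
  · exact absurd h (Finset.notMem_erase _ _)
  · rw [← h]

theorem exists_mem_upSet (lam : PartitionOf n) : ∃ mu, mu ∈ upSet lam := by
  obtain ⟨mu, h, -⟩ := exists_up lam (Or.inl rfl)
  exact ⟨mu, mem_upSet.2 h⟩

theorem exists_mem_downSet (mu : PartitionOf (n + 1)) : ∃ lam, lam ∈ downSet mu := by
  suffices ∃ i, mu.1.rowLen (i + 1) < mu.1.rowLen i by
    obtain ⟨i, hi⟩ := this
    obtain ⟨lam, h, -⟩ := exists_down mu hi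
    exact ⟨lam, mem_downSet.2 h⟩
  by_contra! hne
  -- Row lengths that never drop would make row number `mu.1.card` nonempty, which is out of range.
  have hmono : ∀ i, mu.1.rowLen 0 ≤ mu.1.rowLen i := fun i => by
    induction i with
    | zero => rfl
    | succ i ih => exact ih.trans (hne i)
  have hpos : 0 < mu.1.cells.card := by
    have : mu.1.cells.card = n + 1 := mu.2
    omega
  obtain ⟨c, hc⟩ := Finset.card_pos.1 hpos
  have h0 : 0 < mu.1.rowLen 0 :=
    YoungDiagram.mem_iff_lt_rowLen.1 (mu.1.up_left_mem (Nat.zero_le c.1) (Nat.zero_le c.2) hc)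
  have h1 : (mu.1.card, 0) ∈ mu.1.cells :=
    YoungDiagram.mem_iff_lt_rowLen.2 (h0.trans_le (hmono _))
  exact (row_lt_card h1).false

/-- A diagram has one more addable box than removable boxes. -/
theorem card_upSet (lam : PartitionOf (n + 1)) : (upSet lam).card = (downSet lam).card + 1 := by
  have hup : ∀ mu : upSet lam, lam.1 ≤ mu.1.1 := fun mu => mem_upSet.1 mu.2
  have hdn : ∀ kap : downSet lam, kap.1.1 ≤ lam.1 := fun kap => mem_downSet.1 kap.2
  let e1 : upSet lam ≃ {i // i = 0 ∨ lam.1.rowLen i < lam.1.rowLen (i - 1)} :=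
    Equiv.ofBijective (fun mu => ⟨(addedBox (hup mu)).1, addable_addedBox (hup mu)⟩) (by
      constructor
      · intro mu mu' h
        have h1 : (addedBox (hup mu)).1 = (addedBox (hup mu')).1 := congrArg Subtype.val h
        have h2 : addedBox (hup mu) = addedBox (hup mu') := by
          refine Prod.ext h1 ?_
          rw [addedBox_eq_of_upper, addedBox_eq_of_upper, h1]
        refine Subtype.ext (Subtype.ext (YoungDiagram.ext ?_))
        rw [cells_eq_insert (hup mu), cells_eq_insert (hup mu'), h2]
      · rintro ⟨i, hi⟩
        obtain ⟨mu, h, hb⟩ := exists_up lam hi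
        exact ⟨⟨mu, mem_upSet.2 h⟩, Subtype.ext hb⟩)
  let e2 : downSet lam ≃ {i // lam.1.rowLen (i + 1) < lam.1.rowLen i} :=
    Equiv.ofBijective (fun kap => ⟨(addedBox (hdn kap)).1, (removable_addedBox (hdn kap)).2⟩) (by
      constructor
      · intro kap kap' h
        have h1 : (addedBox (hdn kap)).1 = (addedBox (hdn kap')).1 := congrArg Subtype.val h
        have h2 : addedBox (hdn kap) = addedBox (hdn kap') := by
          refine Prod.ext h1 ?_
          have h3 := (removable_addedBox (hdn kap)).1
          have h4 := (removable_addedBox (hdn kap')).1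
          rw [h1] at h3
          omega
        refine Subtype.ext (Subtype.ext (YoungDiagram.ext ?_))
        rw [← Finset.erase_insert (addedBox_notMem (hdn kap)),
          ← Finset.erase_insert (addedBox_notMem (hdn kap')), ← cells_eq_insert (hdn kap),
          ← cells_eq_insert (hdn kap'), h2]
      · rintro ⟨i, hi⟩
        obtain ⟨kap, h, hb⟩ := exists_down lam hi
        exact ⟨⟨kap, mem_downSet.2 h⟩, Subtype.ext hb⟩)
  -- Row `i + 1` accepts a box exactly when row `i` can lose one; row 0 always accepts a box and
  -- accounts for `none`.
  let e3 : Option {i // lam.1.rowLen (i + 1) < lam.1.rowLen i} ≃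
      {i // i = 0 ∨ lam.1.rowLen i < lam.1.rowLen (i - 1)} :=
    { toFun := fun o => o.elim ⟨0, Or.inl rfl⟩ fun i => ⟨i.1 + 1, Or.inr i.2⟩
      invFun := fun i => match i with
        | ⟨0, _⟩ => none
        | ⟨i + 1, hi⟩ => some ⟨i, hi.resolve_left (Nat.succ_ne_zero i)⟩
      left_inv := by rintro (_ | i) <;> rfl
      right_inv := by rintro ⟨_ | i, hi⟩ <;> rfl }
  have h := Fintype.card_congr ((Equiv.optionCongr e2).trans (e3.trans e1.symm))
  rw [Fintype.card_option, Fintype.card_coe, Fintype.card_coe] at h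
  exact h.symm

theorem eq_of_le_of_card {lam mu : YoungDiagram} (h : lam ≤ mu) (hc : mu.card ≤ lam.card) :
    lam = mu :=
  YoungDiagram.ext (Finset.eq_of_subset_of_card_le (YoungDiagram.cells_subset_iff.2 h) hc)

/-- Two distinct diagrams of the same size have as many common upper neighbours as common lower
neighbours. -/
theorem card_common_upSet {lam nu : PartitionOf (n + 1)} (hne : lam ≠ nu) [DecidableEq (PartitionOf n)]
    [DecidableEq (PartitionOf (n + 2))] :
    (upSet lam ∩ upSet nu).card = (downSet lam ∩ downSet nu).card := by
  have hcard : (lam.1 ⊔ nu.1).card + (lam.1 ⊓ nu.1).card = 2 * (n + 1) := by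
    have h1 : lam.1.cells.card = n + 1 := lam.2
    have h2 : nu.1.cells.card = n + 1 := nu.2
    have h3 := Finset.card_union_add_card_inter lam.1.cells nu.1.cells
    change (lam.1.cells ∪ nu.1.cells).card + (lam.1.cells ∩ nu.1.cells).card = _
    omega
  have hsup : n + 1 < (lam.1 ⊔ nu.1).card := by
    by_contra hle
    apply hne
    apply Subtype.ext
    have h1 := eq_of_le_of_card (le_sup_left : lam.1 ≤ lam.1 ⊔ nu.1) (by rw [lam.2]; omega)
    have h2 := eq_of_le_of_card (le_sup_right : nu.1 ≤ lam.1 ⊔ nu.1) (by rw [nu.2]; omega)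
    exact h1.trans h2.symm
  -- The only possible common upper neighbour is the union and the only possible lower one the
  -- intersection. Their sizes add up to `2 * (n + 1)`, so both exist or neither does.
  have hU : ∀ mu ∈ upSet lam ∩ upSet nu, mu.1 = lam.1 ⊔ nu.1 := by
    intro mu hmu
    rw [Finset.mem_inter, mem_upSet, mem_upSet] at hmu
    refine (eq_of_le_of_card (sup_le hmu.1 hmu.2) ?_).symm
    rw [mu.2]; omega
  have hD : ∀ kap ∈ downSet lam ∩ downSet nu, kap.1 = lam.1 ⊓ nu.1 := by
    intro kap hkap
    rw [Finset.mem_inter, mem_downSet, mem_downSet] at hkap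
    refine eq_of_le_of_card (le_inf hkap.1 hkap.2) ?_
    rw [kap.2]; omega
  by_cases h : (lam.1 ⊔ nu.1).card = n + 2
  · have e1 : upSet lam ∩ upSet nu = {⟨lam.1 ⊔ nu.1, h⟩} := by
      ext mu
      rw [Finset.mem_singleton]
      refine ⟨fun hmu => Subtype.ext (hU mu hmu), ?_⟩
      rintro rfl
      rw [Finset.mem_inter, mem_upSet, mem_upSet]
      exact ⟨le_sup_left, le_sup_right⟩
    have e2 : downSet lam ∩ downSet nu = {⟨lam.1 ⊓ nu.1, by omega⟩} := by
      ext kap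
      rw [Finset.mem_singleton]
      refine ⟨fun hkap => Subtype.ext (hD kap hkap), ?_⟩
      rintro rfl
      rw [Finset.mem_inter, mem_downSet, mem_downSet]
      exact ⟨inf_le_left, inf_le_right⟩
    rw [e1, e2, Finset.card_singleton, Finset.card_singleton]
  · have e1 : upSet lam ∩ upSet nu = ∅ := Finset.eq_empty_of_forall_notMem fun mu hmu =>
      h (by rw [← hU mu hmu]; exact mu.2)
    have e2 : downSet lam ∩ downSet nu = ∅ := Finset.eq_empty_of_forall_notMem fun kap hkap =>
      h (by have := hD kap hkap ▸ kap.2; omega)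
    rw [e1, e2, Finset.card_empty, Finset.card_empty]

/-- The relation `DU = UD + 1`: the coefficient of `f nu` counts common neighbours of `lam` and
`nu`. The two counts agree for `nu ≠ lam` and differ by one for `nu = lam`. -/
theorem sum_up_down (lam : PartitionOf (n + 1)) (f : PartitionOf (n + 1) → ℕ) :
    ∑ mu ∈ upSet lam, ∑ nu ∈ downSet mu, f nu =
      ∑ kap ∈ downSet lam, ∑ nu ∈ upSet kap, f nu + f lam := by
  classical
  have h1 : ∑ mu ∈ upSet lam, ∑ nu ∈ downSet mu, f nu =
      ∑ nu, (upSet lam ∩ upSet nu).card * f nu := by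
    rw [Finset.sum_comm' (t' := Finset.univ) (s' := fun nu => upSet lam ∩ upSet nu)]
    · simp
    · intro mu nu
      simp [mem_upSet, mem_downSet]
  have h2 : ∑ kap ∈ downSet lam, ∑ nu ∈ upSet kap, f nu =
      ∑ nu, (downSet lam ∩ downSet nu).card * f nu := by
    rw [Finset.sum_comm' (t' := Finset.univ) (s' := fun nu => downSet lam ∩ downSet nu)]
    · simp
    · intro mu nu
      simp [mem_upSet, mem_downSet]
  rw [h1, h2, ← Finset.add_sum_erase _ _ (Finset.mem_univ lam),
    ← Finset.add_sum_erase (a := lam) _ (fun nu => (downSet lam ∩ downSet nu).card * f nu)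
      (Finset.mem_univ lam), Finset.inter_self, Finset.inter_self, card_upSet]
  have h3 : ∑ nu ∈ Finset.univ.erase lam, (upSet lam ∩ upSet nu).card * f nu =
      ∑ nu ∈ Finset.univ.erase lam, (downSet lam ∩ downSet nu).card * f nu :=
    Finset.sum_congr rfl fun nu hnu => by
      rw [card_common_upSet (Finset.ne_of_mem_erase hnu).symm]
  rw [h3]
  ring

/-- A function on Young's lattice that dominates the sum of its values on the lower neighbours,
and whose sum over the upper neighbours of `lam` is at most `(n + 1) f(lam)`, satisfies the
branching rule. -/
theorem branching_of_le (f : ∀ n, PartitionOf n → ℕ)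
    (hdown : ∀ n (mu : PartitionOf (n + 1)), ∑ lam ∈ downSet mu, f n lam ≤ f (n + 1) mu)
    (hup : ∀ n (lam : PartitionOf n), ∑ mu ∈ upSet lam, f (n + 1) mu ≤ (n + 1) * f n lam) (n : ℕ) :
    (∀ mu : PartitionOf (n + 1), f (n + 1) mu = ∑ lam ∈ downSet mu, f n lam) ∧
      ∀ lam : PartitionOf n, ∑ mu ∈ upSet lam, f (n + 1) mu = (n + 1) * f n lam := by
  -- This lower bound closes the chain `(n+1) f(lam) ≤ ∑∑ f ≤ ∑ f(mu) ≤ (n+1) f(lam)`. Equality then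
  -- holds for each `mu` above `lam`, and every `mu` lies above some `lam`.
  have step : ∀ n, (∀ lam : PartitionOf n,
      (n + 1) * f n lam ≤ ∑ mu ∈ upSet lam, ∑ nu ∈ downSet mu, f n nu) →
      (∀ mu : PartitionOf (n + 1), f (n + 1) mu = ∑ lam ∈ downSet mu, f n lam) ∧
      ∀ lam : PartitionOf n, ∑ mu ∈ upSet lam, f (n + 1) mu = (n + 1) * f n lam := by
    intro n h
    have hle : ∀ lam : PartitionOf n, ∀ mu ∈ upSet lam,
      ∑ nu ∈ downSet mu, f n nu ≤ f (n + 1) mu := fun _ mu _ => hdown n mu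
    refine ⟨fun mu => ?_, fun lam =>
      (hup n lam).antisymm ((h lam).trans (Finset.sum_le_sum (hle lam)))⟩
    obtain ⟨lam, hl⟩ := exists_mem_downSet mu
    have heq := ((Finset.sum_le_sum (hle lam)).antisymm ((hup n lam).trans (h lam)))
    exact ((Finset.sum_eq_sum_iff_of_le (hle lam)).1 heq mu
      (mem_upSet.2 (mem_downSet.1 hl))).symm
  induction n with
  | zero =>
    refine step 0 fun lam => ?_
    obtain ⟨mu, hmu⟩ := exists_mem_upSet lam
    have h1 : (0 + 1) * f 0 lam = f 0 lam := one_mul _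
    rw [h1]
    exact (Finset.single_le_sum (fun _ _ => Nat.zero_le _)
      (mem_downSet.2 (mem_upSet.1 hmu))).trans
      (Finset.single_le_sum (f := fun mu => ∑ nu ∈ downSet mu, f 0 nu)
        (fun _ _ => Nat.zero_le _) hmu)
  | succ n ih =>
    refine step (n + 1) fun lam => ?_
    -- Both inductive claims turn the double sum into `(n + 1) f(lam) + f(lam)`.
    rw [sum_up_down, Finset.sum_congr rfl fun kap _ => ih.2 kap, ← Finset.mul_sum, ← ih.1 lam]
    exact le_of_eq (by ring)

end YoungLattice

/-! ### The branching rule -/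

section Branching

variable {n : ℕ}

instance finite_specht (lam : PartitionOf n) : Module.Finite ℂ (specht lam) :=
  Module.Finite.of_injective ((specht lam).subtype.restrictScalars ℂ) Subtype.val_injective

instance free_specht (lam : PartitionOf n) : Module.Free ℂ (specht lam) :=
  Module.Free.of_divisionRing (K := ℂ) (V := specht lam)

/-- The complex dimension of a Specht module. -/
def spechtDim (n : ℕ) (lam : PartitionOf n) : ℕ := Module.finrank ℂ (specht lam)

/-- The lifting operator with values in `S^mu`. -/
def liftingTo {lam : PartitionOf n} {mu : PartitionOf (n + 1)} (h : lam.1 ≤ mu.1) :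
    specht lam →ₗ[ℂ] specht mu where
  toFun v := ⟨lifting h v, lifting_mem h v⟩
  map_add' x y := Subtype.ext (map_add _ x y)
  map_smul' c x := Subtype.ext (map_smul _ c x)

instance fintypeLower (mu : PartitionOf (n + 1)) :
    Fintype {lam : PartitionOf n // lam.1 ≤ mu.1} := Fintype.ofFinite _

instance fintypeUpper (lam : PartitionOf n) :
    Fintype {mu : PartitionOf (n + 1) // lam.1 ≤ mu.1} := Fintype.ofFinite _

/-- The sum of all lifting operators with values in `S^mu`. -/
def liftingSum (mu : PartitionOf (n + 1)) :
    (∀ lam : {lam : PartitionOf n // lam.1 ≤ mu.1}, specht lam.1) →ₗ[ℂ] specht mu :=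
  ∑ lam, liftingTo lam.2 ∘ₗ LinearMap.proj lam

theorem liftingSum_apply (mu : PartitionOf (n + 1))
    (v : ∀ lam : {lam : PartitionOf n // lam.1 ≤ mu.1}, specht lam.1) :
    (liftingSum mu v : WordModule (n + 1)) = ∑ lam, lifting lam.2 (v lam) := by
  simp [liftingSum, liftingTo, LinearMap.sum_apply]

theorem liftingSum_single [DecidableEq (PartitionOf n)] (mu : PartitionOf (n + 1))
    (lam : {lam : PartitionOf n // lam.1 ≤ mu.1}) (v : specht lam.1) :
    (liftingSum mu (Pi.single lam v) : WordModule (n + 1)) = lifting lam.2 v := by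
  rw [liftingSum_apply, Finset.sum_eq_single_of_mem lam (Finset.mem_univ _), Pi.single_eq_same]
  intro lam' _ hne
  rw [Pi.single_eq_of_ne hne, map_zero]

theorem isotypicProj_sum_specht {ι : Type*} [Fintype ι] (nu : ι → PartitionOf n)
    (hnu : Function.Injective nu) (v : ∀ i, specht (nu i)) (i : ι) :
    isotypicProj (GroupAlg n) (WordModule n) (specht (nu i)) (∑ j, (v j : WordModule n)) = v i := by
  rw [map_sum, Finset.sum_eq_single_of_mem i (Finset.mem_univ _),
    isotypicProj_of_mem_specht (v i).2]
  intro j _ hne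
  exact isotypicProj_of_mem_specht_of_ne (fun h => hne (hnu h)) (v j).2

/-- The sum of elements of several Specht modules. -/
def spechtSum {ι : Type*} [Fintype ι] (nu : ι → PartitionOf n) :
    (∀ i, specht (nu i)) →ₗ[ℂ] WordModule n where
  toFun v := ∑ i, (v i : WordModule n)
  map_add' v w := by simp [Finset.sum_add_distrib]
  map_smul' c v := by simp [Finset.smul_sum]

theorem spechtSum_apply {ι : Type*} [Fintype ι] (nu : ι → PartitionOf n)
    (v : ∀ i, specht (nu i)) : spechtSum nu v = ∑ i, (v i : WordModule n) := rfl

theorem spechtSum_injective {ι : Type*} [Fintype ι] (nu : ι → PartitionOf n)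
    (hnu : Function.Injective nu) : Function.Injective (spechtSum nu) := by
  intro v w h
  rw [spechtSum_apply, spechtSum_apply] at h
  funext i
  apply Subtype.ext
  rw [← isotypicProj_sum_specht nu hnu v i, h, isotypicProj_sum_specht nu hnu w i]

/-- The map `∑_lam π^mu Φ_a π^lam` on `M^n`. -/
def globalLifting (mu : PartitionOf (n + 1)) : WordModule n →ₗ[ℂ] WordModule (n + 1) :=
  ∑ lam : {lam : PartitionOf n // lam.1 ≤ mu.1},
    (isotypicProj (GroupAlg (n + 1)) (WordModule (n + 1)) (specht mu)).restrictScalars ℂ ∘ₗ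
      adding (addedRow lam.2) ∘ₗ
        (isotypicProj (GroupAlg n) (WordModule n) (specht lam.1)).restrictScalars ℂ

theorem globalLifting_apply (mu : PartitionOf (n + 1)) (x : WordModule n) :
    globalLifting mu x = ∑ lam : {lam : PartitionOf n // lam.1 ≤ mu.1},
      isotypicProj (GroupAlg (n + 1)) (WordModule (n + 1)) (specht mu)
        (adding (addedRow lam.2)
          (isotypicProj (GroupAlg n) (WordModule n) (specht lam.1) x)) := by
  simp [globalLifting, LinearMap.sum_apply]

theorem globalLifting_smul (mu : PartitionOf (n + 1)) (σ : Perm (Fin n)) (x : WordModule n) :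
    globalLifting mu ((MonoidAlgebra.single σ 1 : GroupAlg n) • x) =
      (MonoidAlgebra.single (inclPerm σ) 1 : GroupAlg (n + 1)) • globalLifting mu x := by
  rw [globalLifting_apply, globalLifting_apply, Finset.smul_sum]
  refine Finset.sum_congr rfl fun lam _ => ?_
  rw [map_smul, adding_smul, map_smul]

theorem globalLifting_sum (mu : PartitionOf (n + 1))
    (v : ∀ lam : {lam : PartitionOf n // lam.1 ≤ mu.1}, specht lam.1) :
    globalLifting mu (∑ lam, (v lam : WordModule n)) = liftingSum mu v := by
  rw [globalLifting_apply, liftingSum_apply]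
  refine Finset.sum_congr rfl fun lam _ => ?_
  rw [isotypicProj_sum_specht (fun lam : {lam : PartitionOf n // lam.1 ≤ mu.1} => lam.1)
    Subtype.val_injective v lam, lifting_apply]

/-- The sum of the liftings extends to the equivariant map `globalLifting` on `M^n`. Its kernel is a
submodule, so with `∑ v_lam` it contains each isotypic component `v_lam`, and the single liftings
are injective. -/
theorem liftingSum_injective (mu : PartitionOf (n + 1)) :
    Function.Injective (liftingSum mu) := by
  classical
  rw [injective_iff_map_eq_zero]
  intro v hv
  have hx : ∑ lam, (v lam : WordModule n) ∈
      equivariantKer (globalLifting mu) (globalLifting_smul mu) := by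
    change globalLifting mu _ = 0
    rw [globalLifting_sum, hv]
    rfl
  funext lam
  have h1 := isotypicProj_mem_submodule (S := specht lam.1) _ hx
  rw [isotypicProj_sum_specht (fun lam : {lam : PartitionOf n // lam.1 ≤ mu.1} => lam.1)
    Subtype.val_injective v lam] at h1
  have h2 : ∑ lam', ((Pi.single lam (v lam) :
      ∀ lam : {lam : PartitionOf n // lam.1 ≤ mu.1}, specht lam.1) lam' : WordModule n) =
      v lam := by
    rw [Finset.sum_eq_single_of_mem lam (Finset.mem_univ _), Pi.single_eq_same]
    intro lam' _ hne
    rw [Pi.single_eq_of_ne hne]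
    rfl
  have h3 : globalLifting mu (v lam) = 0 := h1
  rw [← h2, globalLifting_sum, liftingSum_single] at h3
  exact lifting_injective lam.2 (h3.trans (map_zero _).symm)

theorem sum_spechtDim_le (mu : PartitionOf (n + 1)) :
    ∑ lam ∈ downSet mu, spechtDim n lam ≤ spechtDim (n + 1) mu := by
  rw [Finset.sum_subtype (downSet mu) (p := fun lam => lam.1 ≤ mu.1) fun _ => mem_downSet]
  have h := LinearMap.finrank_le_finrank_of_injective (liftingSum_injective mu)
  rwa [Module.finrank_pi_fintype] at h

/-- The map `v ↦ ∑_mu κ^{lam,mu} v`. -/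
def diagonalLifting (lam : PartitionOf n) : specht lam →ₗ[ℂ] WordModule (n + 1) :=
  ∑ mu : {mu : PartitionOf (n + 1) // lam.1 ≤ mu.1}, lifting mu.2

theorem diagonalLifting_apply (lam : PartitionOf n) (v : specht lam) :
    diagonalLifting lam v =
      ∑ mu : {mu : PartitionOf (n + 1) // lam.1 ≤ mu.1}, lifting mu.2 v := by
  simp [diagonalLifting, LinearMap.sum_apply]

theorem diagonalLifting_smul (lam : PartitionOf n) (σ : Perm (Fin n)) (v : specht lam) :
    diagonalLifting lam ((MonoidAlgebra.single σ 1 : GroupAlg n) • v) =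
      (MonoidAlgebra.single (inclPerm σ) 1 : GroupAlg (n + 1)) • diagonalLifting lam v := by
  rw [diagonalLifting_apply, diagonalLifting_apply, Finset.smul_sum]
  exact Finset.sum_congr rfl fun mu _ => lifting_smul mu.2 σ v

/-- The sum of the translates of `diagonalLifting` by the coset representatives of `S_n` in
`S_{n+1}`. -/
def cosetSum (lam : PartitionOf n) : (Fin (n + 1) → specht lam) →ₗ[ℂ] WordModule (n + 1) :=
  ∑ i : Fin (n + 1), Algebra.lsmul ℂ ℂ (WordModule (n + 1))
      (MonoidAlgebra.single (swap i (Fin.last n)) 1 : GroupAlg (n + 1)) ∘ₗ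
    diagonalLifting lam ∘ₗ LinearMap.proj i

theorem cosetSum_apply (lam : PartitionOf n) (v : Fin (n + 1) → specht lam) :
    cosetSum lam v = ∑ i, (MonoidAlgebra.single (swap i (Fin.last n)) 1 : GroupAlg (n + 1)) •
      diagonalLifting lam (v i) := by
  simp [cosetSum, LinearMap.sum_apply]

theorem smul_swap_diagonalLifting_mem (lam : PartitionOf n) (i : Fin (n + 1)) (v : specht lam) :
    (MonoidAlgebra.single (swap i (Fin.last n)) 1 : GroupAlg (n + 1)) • diagonalLifting lam v ∈
      LinearMap.range (cosetSum lam) := by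
  refine ⟨Pi.single i v, ?_⟩
  rw [cosetSum_apply, Finset.sum_eq_single_of_mem i (Finset.mem_univ _), Pi.single_eq_same]
  intro j _ hne
  rw [Pi.single_eq_of_ne hne, map_zero, smul_zero]

/-- The range of `cosetSum`, which is stable under `S_{n+1}`. -/
def cosetSpan (lam : PartitionOf n) : Submodule (GroupAlg (n + 1)) (WordModule (n + 1)) :=
  MonoidAlgebra.submoduleOfSMulMem (LinearMap.range (cosetSum lam)) (by
    rintro σ _ ⟨v, rfl⟩
    rw [cosetSum_apply, Finset.smul_sum]
    refine Submodule.sum_mem _ fun i _ => ?_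
    -- Coset decomposition: `σ` times a representative is the representative for `σ i` times an
    -- element of `S_n`, which moves inside the equivariant diagonal lift.
    obtain ⟨ρ, hρ⟩ := exists_inclPerm_eq
      (τ := swap (σ i) (Fin.last n) * σ * swap i (Fin.last n)) (by simp)
    have h : σ * swap i (Fin.last n) = swap (σ i) (Fin.last n) * inclPerm ρ := by
      rw [hρ, ← mul_assoc, ← mul_assoc, swap_mul_self, one_mul]
    rw [smul_smul, MonoidAlgebra.of_apply, MonoidAlgebra.single_mul_single, h, mul_one,
      ← mul_one (1 : ℂ), ← MonoidAlgebra.single_mul_single, mul_smul, ← diagonalLifting_smul]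
    exact smul_swap_diagonalLifting_mem lam _ _)

theorem diagonalLifting_mem (lam : PartitionOf n) (v : specht lam) :
    diagonalLifting lam v ∈ cosetSpan lam := by
  have h := smul_swap_diagonalLifting_mem lam (Fin.last n) v
  rw [swap_self] at h
  have h1 : (MonoidAlgebra.single (Equiv.refl (Fin (n + 1))) 1 : GroupAlg (n + 1)) = 1 := rfl
  rw [h1, one_smul] at h
  exact h

/-- `π^mu` preserves the submodule `cosetSpan lam` and extracts from a diagonal lift its component
in `S^mu`. That component is nonzero, so it generates the simple module `S^mu`. -/
theorem specht_le_cosetSpan {lam : PartitionOf n} {mu : PartitionOf (n + 1)} (h : lam.1 ≤ mu.1) :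
    specht mu ≤ cosetSpan lam := by
  obtain ⟨T⟩ := nonempty_tableau lam
  set t : specht lam := ⟨polytabloid T, polytabloid_mem T⟩
  have h1 := isotypicProj_mem_submodule (S := specht mu) _ (diagonalLifting_mem lam t)
  rw [diagonalLifting_apply] at h1
  have h2 := isotypicProj_sum_specht
    (fun mu : {mu : PartitionOf (n + 1) // lam.1 ≤ mu.1} => mu.1) Subtype.val_injective
    (fun mu => ⟨lifting mu.2 t, lifting_mem mu.2 t⟩) ⟨mu, h⟩
  simp only at h2
  rw [h2] at h1
  have hne : lifting h t ≠ 0 := fun h0 => by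
    have := lifting_injective h (h0.trans (map_zero _).symm)
    exact polytabloid_ne_zero T (congrArg Subtype.val this)
  have hs := (isSimpleModule_iff (GroupAlg (n + 1)) (specht mu)).1 inferInstance
  rcases hs.eq_bot_or_eq_top ((cosetSpan lam).comap (specht mu).subtype) with hb | ht
  · have : (⟨lifting h t, lifting_mem h t⟩ : specht mu) ∈
      (cosetSpan lam).comap (specht mu).subtype := h1
    rw [hb, Submodule.mem_bot] at this
    exact absurd (congrArg Subtype.val this) hne
  · intro x hx
    have : (⟨x, hx⟩ : specht mu) ∈ (cosetSpan lam).comap (specht mu).subtype := by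
      rw [ht]; trivial
    exact this

/-- The independent modules `S^mu` all lie in the image of `n + 1` copies of `S^lam`. -/
theorem sum_spechtDim_upSet_le (lam : PartitionOf n) :
    ∑ mu ∈ upSet lam, spechtDim (n + 1) mu ≤ (n + 1) * spechtDim n lam := by
  rw [Finset.sum_subtype (upSet lam) (p := fun mu => lam.1 ≤ mu.1) fun _ => mem_upSet]
  let nu : {mu : PartitionOf (n + 1) // lam.1 ≤ mu.1} → PartitionOf (n + 1) := fun mu => mu.1
  have hrange : LinearMap.range (spechtSum nu) ≤ LinearMap.range (cosetSum lam) := by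
    rintro _ ⟨v, rfl⟩
    rw [spechtSum_apply]
    exact Submodule.sum_mem _ fun mu _ => specht_le_cosetSpan mu.2 (v mu).2
  have h1 : Module.finrank ℂ (LinearMap.range (spechtSum nu)) =
      ∑ mu : {mu : PartitionOf (n + 1) // lam.1 ≤ mu.1}, spechtDim (n + 1) mu.1 := by
    rw [LinearMap.finrank_range_of_inj (spechtSum_injective nu Subtype.val_injective),
      Module.finrank_pi_fintype]
    rfl
  have h2 := LinearMap.finrank_range_le (cosetSum lam)
  rw [Module.finrank_pi_fintype, Finset.sum_const, Finset.card_univ, Fintype.card_fin,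
    smul_eq_mul] at h2
  rw [← h1]
  exact (Submodule.finrank_mono hrange).trans h2

/-- The branching rule for the dimensions of the Specht modules. -/
theorem spechtDim_eq_sum (mu : PartitionOf (n + 1)) :
    spechtDim (n + 1) mu = ∑ lam ∈ downSet mu, spechtDim n lam :=
  (branching_of_le spechtDim (fun _ => sum_spechtDim_le) (fun _ => sum_spechtDim_upSet_le) n).1 mu

theorem finrank_pi_specht (mu : PartitionOf (n + 1)) :
    Module.finrank ℂ (∀ lam : {lam : PartitionOf n // lam.1 ≤ mu.1}, specht lam.1) =
      Module.finrank ℂ (specht mu) := by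
  refine Eq.trans ?_ (spechtDim_eq_sum mu).symm
  rw [Module.finrank_pi_fintype,
    Finset.sum_subtype (downSet mu) (p := fun lam => lam.1 ≤ mu.1) fun _ => mem_downSet]
  rfl

/-- The sum of the lifting operators is an isomorphism `⨁_lam S^lam ≃ S^mu`. -/
def liftingEquiv (mu : PartitionOf (n + 1)) :
    (∀ lam : {lam : PartitionOf n // lam.1 ≤ mu.1}, specht lam.1) ≃ₗ[ℂ] specht mu :=
  LinearEquiv.ofBijective (liftingSum mu) ⟨liftingSum_injective mu,
    (LinearMap.injective_iff_surjective_of_finrank_eq_finrank (K := ℂ)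
      (V := ∀ lam : {lam : PartitionOf n // lam.1 ≤ mu.1}, specht lam.1) (V₂ := specht mu)
      (f := liftingSum mu) (finrank_pi_specht mu)).1 (liftingSum_injective mu)⟩

end Branching

/-! ### The action of the shuffle element on lifted eigenvectors -/

section Eigenvectors

variable {n : ℕ}

/-- The central element `∑_{i, j} (i j)`. -/
def transpositionSum (n : ℕ) : GroupAlg n :=
  ∑ i : Fin n, ∑ j : Fin n, MonoidAlgebra.single (swap i j) 1

theorem single_mul_transpositionSum (σ : Perm (Fin n)) :
    MonoidAlgebra.single σ 1 * transpositionSum n = transpositionSum n * MonoidAlgebra.single σ 1 := by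
  unfold transpositionSum
  rw [Finset.mul_sum, Finset.sum_mul]
  refine Fintype.sum_equiv σ _ _ fun i => ?_
  rw [Finset.mul_sum, Finset.sum_mul]
  refine Fintype.sum_equiv σ _ _ fun j => ?_
  rw [MonoidAlgebra.single_mul_single, MonoidAlgebra.single_mul_single, mul_swap_eq_swap_mul]

/-- A central element acts by a module endomorphism, hence by a scalar. -/
theorem exists_transpositionSum_smul (lam : PartitionOf n) :
    ∃ d : ℂ, ∀ x : specht lam, transpositionSum n • x = d • x := by
  let φ : specht lam →ₗ[GroupAlg n] specht lam :=
    MonoidAlgebra.equivariantOfLinearOfComm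
      (Algebra.lsmul ℂ ℂ (specht lam) (transpositionSum n)) fun σ v => by
        rw [Algebra.lsmul_apply, Algebra.lsmul_apply, smul_smul, smul_smul,
          single_mul_transpositionSum]
  obtain ⟨d, hd⟩ := exists_hom_eq_smul φ
  exact ⟨d, fun x => hd x⟩

/-- The sum `∑_{i ≤ n} (i n+1)`, a Jucys-Murphy element. -/
def lastSum (n : ℕ) : GroupAlg (n + 1) :=
  ∑ i : Fin n, MonoidAlgebra.single (swap i.castSucc (Fin.last n)) 1

/-- The sum runs over ordered pairs, so each `(i n+1)` occurs twice, and the new diagonal pair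
contributes the identity. -/
theorem transpositionSum_succ :
    transpositionSum (n + 1) = inclAlg n (transpositionSum n) + (2 : ℂ) • lastSum n + 1 := by
  unfold transpositionSum lastSum
  simp only [Fin.sum_univ_castSucc, map_sum, inclAlg_single, inclPerm_swap,
    Finset.sum_add_distrib, swap_comm (Fin.last n)]
  have h1 : (MonoidAlgebra.single (swap (Fin.last n) (Fin.last n)) 1 : GroupAlg (n + 1)) = 1 := by
    rw [swap_self]; rfl
  rw [h1, two_smul]
  abel

theorem shuffle_succ :
    shuffle (n + 1) = inclAlg n (shuffle n) + (1 / ((n : ℂ) + 1)) • (lastSum n + 1) := by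
  have hS : ∀ m, shuffle m = ∑ j : Fin m, ∑ i : Fin m,
      if i ≤ j then MonoidAlgebra.single (swap i j) (1 / ((j : ℂ) + 1)) else 0 := by
    intro m
    unfold shuffle
    refine Finset.sum_congr rfl fun j _ => ?_
    rw [← Finset.sum_filter]
    congr 1
    ext i
    simp
  have h1 : (MonoidAlgebra.single (swap (Fin.last n) (Fin.last n)) (1 / ((n : ℂ) + 1)) :
      GroupAlg (n + 1)) = (1 / ((n : ℂ) + 1)) • 1 := by
    rw [swap_self, MonoidAlgebra.one_def, MonoidAlgebra.smul_single, smul_eq_mul, mul_one]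
    rfl
  rw [hS, hS, Fin.sum_univ_castSucc]
  simp only [Fin.sum_univ_castSucc, map_sum, Fin.castSucc_le_castSucc_iff, Fin.val_castSucc,
    Fin.val_last, Fin.le_last, if_true, h1, lastSum, smul_add, Finset.smul_sum]
  congr 1
  · refine Finset.sum_congr rfl fun j _ => ?_
    rw [if_neg (Fin.castSucc_lt_last j).not_ge, add_zero]
    refine Finset.sum_congr rfl fun i _ => ?_
    split_ifs
    · rw [inclAlg_single, inclPerm_swap]
    · rw [map_zero]
  · congr 1
    refine Finset.sum_congr rfl fun i _ => ?_
    rw [MonoidAlgebra.smul_single, smul_eq_mul, mul_one]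

/-- The lifting intertwines `Q_n` and `Z_n`, while `Z_{n+1}` is scalar on `S^mu`; so the lift is a
common eigenvector of `Q_n` and of the Jucys-Murphy element in `shuffle_succ`. -/
theorem isShuffleEigenvector_lifting {lam : PartitionOf n} {mu : PartitionOf (n + 1)}
    (h : lam.1 ≤ mu.1) {v : specht lam} (hv : IsShuffleEigenvector (v : WordModule n)) :
    IsShuffleEigenvector (lifting h v) := by
  obtain ⟨hv0, c, hc⟩ := hv
  have hc' : shuffle n • v = c • v := Subtype.ext hc
  obtain ⟨d, hd⟩ := exists_transpositionSum_smul lam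
  obtain ⟨d', hd'⟩ := exists_transpositionSum_smul mu
  set x := lifting h v with hx
  have key := map_groupAlg_smul (lifting h) (lifting_smul h)
  have h1 : inclAlg n (shuffle n) • x = c • x := by
    rw [hx, ← key, hc', map_smul]
  have h2 : inclAlg n (transpositionSum n) • x = d • x := by
    rw [hx, ← key, hd, map_smul]
  have h3 : transpositionSum (n + 1) • x = d' • x :=
    congrArg Subtype.val (hd' ⟨x, lifting_mem h v⟩)
  -- Solve `Z_{n+1} = Z_n + 2J + 1` for `J`, with `d'` and `d` the scalars of `Z_{n+1}` and `Z_n`.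
  have h4 : lastSum n • x = ((d' - d - 1) / 2) • x := by
    rw [transpositionSum_succ, add_smul, add_smul, h2, one_smul, smul_assoc] at h3
    have h5 : (2 : ℂ) • lastSum n • x = (d' - d - 1) • x := by
      rw [sub_smul, sub_smul, ← h3, one_smul]
      abel
    rw [div_eq_inv_mul, mul_smul, ← h5, inv_smul_smul₀ two_ne_zero]
  refine ⟨fun h0 => hv0 ?_, c + 1 / ((n : ℂ) + 1) * ((d' - d - 1) / 2 + 1), ?_⟩
  · exact congrArg Subtype.val (lifting_injective h (h0.trans (map_zero _).symm))
  · rw [shuffle_succ, add_smul, h1, smul_assoc, add_smul, h4, one_smul, add_smul, mul_smul,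
      add_smul, one_smul]

/-- The lifts of bases of the `S^lam` form a basis of `S^mu`. -/
def liftedBasis (mu : PartitionOf (n + 1)) {ι : {lam : PartitionOf n // lam.1 ≤ mu.1} → Type*}
    (b : ∀ lam : {lam : PartitionOf n // lam.1 ≤ mu.1}, Module.Basis (ι lam) ℂ (specht lam.1)) :
    Module.Basis (Σ lam, ι lam) ℂ (specht mu) :=
  (Pi.basis b).map (liftingEquiv mu)

theorem coe_liftedBasis (mu : PartitionOf (n + 1))
    {ι : {lam : PartitionOf n // lam.1 ≤ mu.1} → Type*}
    (b : ∀ lam : {lam : PartitionOf n // lam.1 ≤ mu.1}, Module.Basis (ι lam) ℂ (specht lam.1))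
    (p : Σ lam, ι lam) :
    (liftedBasis mu b p : WordModule (n + 1)) = lifting p.1.2 (b p.1 p.2) := by
  classical
  rw [← liftingSum_single mu p.1, liftedBasis, Module.Basis.map_apply, Pi.basis_apply]
  change (liftingSum mu _ : WordModule (n + 1)) = _
  congr!

theorem exists_eigenbasis (n : ℕ) (lam : PartitionOf n) :
    ∃ (d : ℕ) (b : Module.Basis (Fin d) ℂ (specht lam)),
      ∀ i, IsShuffleEigenvector (b i : WordModule n) := by
  induction n with
  | zero =>
    let b := Module.finBasis ℂ (specht lam)
    refine ⟨_, b, fun i => ⟨fun h => b.ne_zero i (Subtype.ext h), 0, ?_⟩⟩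
    -- `Q_0` is an empty sum, so every nonzero vector is an eigenvector with eigenvalue 0.
    have : shuffle 0 = 0 := by simp [shuffle]
    rw [this, zero_smul ℂ]
    exact zero_smul (GroupAlg 0) (b i : WordModule 0)
  | succ n ih =>
    choose d b hb using fun kap : {kap : PartitionOf n // kap.1 ≤ lam.1} => ih kap.1
    refine ⟨_, (liftedBasis lam b).reindex (Fintype.equivFin _), fun i => ?_⟩
    rw [Module.Basis.reindex_apply, coe_liftedBasis]
    exact isShuffleEigenvector_lifting _ (hb _ _)

end Eigenvectors

end OneSidedShuffle

end

theorem theoremA (n : ℕ) (mu : PartitionOf (n + 1)) :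
    -- the lifting maps are injective `S_n`-module morphisms from `S^lam` into `S^mu`
    (∀ (lam : PartitionOf n) (h : lam.1 ≤ mu.1),
      (∀ v, lifting h v ∈ specht mu) ∧
      Function.Injective (lifting h) ∧
      ∀ (σ : Equiv.Perm (Fin n)) (v : specht lam),
        lifting h ((MonoidAlgebra.single σ 1 : GroupAlg n) • v) =
          (MonoidAlgebra.single (inclPerm σ) 1 : GroupAlg (n + 1)) • lifting h v) ∧
    -- every `S^lam` with `lam ⊂ mu` has a basis of eigenvectors of `Q_n`
    (∀ lam : PartitionOf n, lam.1 ≤ mu.1 →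
      ∃ (d : ℕ) (b : Module.Basis (Fin d) ℂ (specht lam)),
        ∀ i, IsShuffleEigenvector (b i : WordModule n)) ∧
    -- the lifts of such bases form, together, a basis of `S^mu` of eigenvectors of `Q_{n+1}`
    (∀ (ι : {lam : PartitionOf n // lam.1 ≤ mu.1} → Type*)
      (b : ∀ lam : {lam : PartitionOf n // lam.1 ≤ mu.1}, Module.Basis (ι lam) ℂ (specht lam.1)),
      (∀ lam i, IsShuffleEigenvector (b lam i : WordModule n)) →
      ∃ B : Module.Basis (Σ lam, ι lam) ℂ (specht mu),
        ∀ p : Σ lam, ι lam,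
          (B p : WordModule (n + 1)) = lifting p.1.2 (b p.1 p.2) ∧
          IsShuffleEigenvector (B p : WordModule (n + 1))) := by
  refine ⟨fun lam h => ⟨lifting_mem h, lifting_injective h, lifting_smul h⟩,
    fun lam _ => exists_eigenbasis n lam, fun ι b hb => ⟨liftedBasis mu b, fun p => ?_⟩⟩
  rw [coe_liftedBasis]
  exact ⟨rfl, isShuffleEigenvector_lifting p.1.2 (hb p.1 p.2)⟩
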